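/- Consider a Markov decision process with (measurable) state space $\mathcal S$, action space $\mathscr A$, transition kernel $P(s'|s,a)$, reward function $r(s,a,s')$ and discount factor $\gamma\in(0,1)$; let $\pi:\mathcal S\to\mathscr A$ be a stationary policy, $\nu$ a stationary distribution of the Markov chain that $\pi$ induces on $\mathcal S$, and $\phi:\mathcal S\to\mathbb R^d$ a feature map. For $s\sim\nu$, $s'\sim P(\cdot|s,\pi(s))$ write $\phi=\phi(s)$, $\phi'=\phi(s')$, $r=r(s,\pi(s),s')$, and put $$A=\mathbb E_\nu[\phi(\phi-\gamma\phi')^\top],\qquad b=\mathbb E_\nu[r\phi],\qquad \theta^*=A^{-1}b .$$ Let $(\phi_n,\phi_n',r_n)_{n\ge 0}$ be i.i.d. copies of $(\phi,\phi',r)$, let $\theta_0\in\mathbb R^d$ be a fixed initial point, and let the (unprojected) TD(0) iterates be $$\theta_{n+1}=\theta_n+\alpha_n\,[r_n+\gamma\phi_n'^\top\theta_n-\phi_n^\top\theta_n]\,\phi_n,\qquad \alpha_n=\frac1{n+1}.$$ Assume that $\|\phi(s)\|\le \tfrac12$ and $|r(s,a,s')|\le 1$ for all $s,s'\in\mathcal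 S$, $a\in\mathscr A$, and let $0<\lambda<\min_{i\in[d]}\mathrm{Re}\,\lambda_i(A)$, where $\lambda_1(A),\dots,\lambda_d(A)$ are the eigenvalues of $A$. Then there is a function $N(\epsilon,\delta)$, $\epsilon>0$, $\delta\in(0,1)$, such that for all $\epsilon>0$ and $\delta\in(0,1)$ $$\Pr\{\|\theta_n-\theta^*\|\le\epsilon\ \ \forall n\ge N(\epsilon,\delta)\}\ \ge\ 1-\delta$$ and $$N(\epsilon,\delta)=\tilde O(f(\epsilon,\delta)),\qquad f(\epsilon,\delta)=\max\left\{\left[\tfrac1\epsilon\right]^{1+\frac1\lambda}\left[\ln\tfrac1\delta\right]^{1+\frac1\lambda},\ \left[\tfrac1\epsilon\right]^{2}\left[\ln\tfrac1\delta\right]^{3}\right\}.$$ Here $\tilde O$ hides constants and poly-logarithmic factors that depend only on the problem (the decision process, the policy, $\nu$, the features, $\theta_0$ and $\lambda$), in the following sense: there is $k\in\mathbb N$ such that for all $\epsilon_0>0$ and $\delta_0\in(0,1)$ there is a constant $C$ with $N(\epsilon,\delta)\le C\,f(\epsilon,\delta)\,[\ln(2+f(\epsilon,\delta))]^k$ for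 all $0<\epsilon\le\epsilon_0$ and $0<\delta\le\delta_0$. -/

import Mathlib

open MeasureTheory ProbabilityTheory Set
open scoped ENNReal

namespace TDZero

/-- The parameter space `ℝ^d` with the Euclidean norm. -/
abbrev Vec (d : ℕ) : Type := EuclideanSpace ℝ (Fin d)

/-- A Markov decision process on a measurable state space `S` with a measurable action space `Act`:
a transition kernel `P(ds' | s, a)`, a reward function and a discount factor in `(0, 1)`.
(For finite or countable spaces take the discrete sigma-algebras.) -/
structure MDP (S Act : Type*) [MeasurableSpace S] [MeasurableSpace Act] where
  /-- the transition kernel `P(ds' | s, a)` -/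
  P : Kernel (S × Act) S
  markov : IsMarkovKernel P
  /-- the reward `r(s, a, s')` -/
  reward : S → Act → S → ℝ
  measurable_reward : Measurable (fun p : S × Act × S => reward p.1 p.2.1 p.2.2)
  /-- the discount factor -/
  γ : ℝ
  γ_pos : 0 < γ
  γ_lt_one : γ < 1

/-- A stationary deterministic policy. -/
structure Policy (S Act : Type*) [MeasurableSpace S] [MeasurableSpace Act] where
  act : S → Act
  measurable_act : Measurable act

/-- A feature map `φ : S → ℝ^d`. -/
structure Features (S : Type*) [MeasurableSpace S] (d : ℕ) where
  φ : S → Vec d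
  measurable_φ : Measurable φ

noncomputable section

variable {S Act : Type*} [MeasurableSpace S] [MeasurableSpace Act] {d : ℕ}

/-- The Markov chain induced on the states by the policy: `s ↦ P(ds' | s, π(s))`. -/
def MDP.chain (M : MDP S Act) (π : Policy S Act) : Kernel S S :=
  M.P.comap (fun s => (s, π.act s)) (measurable_id.prodMk π.measurable_act)

instance MDP.chain_markov (M : MDP S Act) (π : Policy S Act) : IsMarkovKernel (M.chain π) :=
  haveI := M.markov
  inferInstanceAs (IsMarkovKernel (M.P.comap _ _))

/-- The law of a pair `(s, s')` where `s ∼ ν` and `s' ∼ P(· | s, π(s))`. -/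
def MDP.transitionLaw (M : MDP S Act) (π : Policy S Act) (ν : Measure S) : Measure (S × S) :=
  ν ⊗ₘ M.chain π

/-- The matrix `A = E_ν[φ (φ - γ φ')ᵀ]`. -/
def MDP.A (M : MDP S Act) (π : Policy S Act) (ν : Measure S) (F : Features S d) :
    Matrix (Fin d) (Fin d) ℝ :=
  Matrix.of fun i j =>
    ∫ p, F.φ p.1 i * (F.φ p.1 j - M.γ * F.φ p.2 j) ∂(M.transitionLaw π ν)

/-- The vector `b = E_ν[r φ]`. -/
def MDP.b (M : MDP S Act) (π : Policy S Act) (ν : Measure S) (F : Features S d) : Fin d → ℝ :=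
  fun i => ∫ p, M.reward p.1 (π.act p.1) p.2 * F.φ p.1 i ∂(M.transitionLaw π ν)

/-- The limit point `θ* = A⁻¹ b`. -/
def MDP.θstar (M : MDP S Act) (π : Policy S Act) (ν : Measure S) (F : Features S d) : Vec d :=
  WithLp.toLp 2 ((M.A π ν F)⁻¹.mulVec (M.b π ν F))

/-- The law of the triple `(φ, φ', r) = (φ(s), φ(s'), r(s, π(s), s'))`. -/
def MDP.sampleLaw (M : MDP S Act) (π : Policy S Act) (ν : Measure S) (F : Features S d) :
    Measure (Vec d × Vec d × ℝ) :=
  (M.transitionLaw π ν).map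
    (fun p => (F.φ p.1, F.φ p.2, M.reward p.1 (π.act p.1) p.2))

/-- `Z 0, Z 1, …` are independent random variables, each with law `ρ`. -/
structure IsIIDSample {Ω E : Type*} [MeasurableSpace Ω] [MeasurableSpace E]
    (Pr : Measure Ω) (ρ : Measure E) (Z : ℕ → Ω → E) : Prop where
  measurable : ∀ n, Measurable (Z n)
  indep : iIndepFun Z Pr
  law : ∀ n, Pr.map (Z n) = ρ

/-- The TD(0) iterates with stepsizes `α n`, discount factor `γ`, initial point `θ₀` and data
`z n = (φ_n, φ'_n, r_n)`:
`θ_{n+1} = θ_n + α_n [r_n + γ φ'_nᵀ θ_n - φ_nᵀ θ_n] φ_n`. -/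
def iterate (γ : ℝ) (α : ℕ → ℝ) (θ₀ : Vec d) (z : ℕ → Vec d × Vec d × ℝ) : ℕ → Vec d
  | 0 => θ₀
  | n + 1 =>
      iterate γ α θ₀ z n +
        (α n * ((z n).2.2 + γ * inner ℝ (z n).2.1 (iterate γ α θ₀ z n)
          - inner ℝ (z n).1 (iterate γ α θ₀ z n))) • (z n).1

/-- Uniformly bounded features and rewards: `‖φ(s)‖ ≤ 1/2` and `|r(s, a, s')| ≤ 1`. -/
def MDP.Bounded (M : MDP S Act) (F : Features S d) : Prop :=
  (∀ s, ‖F.φ s‖ ≤ 1 / 2) ∧ ∀ s a s', |M.reward s a s'| ≤ 1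

/-- `N(ε, δ) = Õ(f(ε, δ))` for `ε > 0`, `δ ∈ (0, 1)`: up to a constant and a power of the logarithm
of `f`, the function `N` is at most `f`, uniformly over all `ε` that stay bounded and
all `δ` that stay away from `1`. -/
def IsSoftO (N : ℝ → ℝ → ℕ) (f : ℝ → ℝ → ℝ) : Prop :=
  ∃ k : ℕ, ∀ ε₀ : ℝ, 0 < ε₀ → ∀ δ₀ ∈ Ioo (0 : ℝ) 1, ∃ C : ℝ, ∀ ε ∈ Ioc 0 ε₀, ∀ δ ∈ Ioc 0 δ₀,
    (N ε δ : ℝ) ≤ C * f ε δ * Real.log (2 + f ε δ) ^ k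

/-- The rate `max{(1/ε)^{1+1/λ} (ln 1/δ)^{1+1/λ}, (1/ε)² (ln 1/δ)³}`. -/
def rate (lam ε δ : ℝ) : ℝ :=
  max ((1 / ε) ^ (1 + 1 / lam) * Real.log (1 / δ) ^ (1 + 1 / lam))
    ((1 / ε) ^ 2 * Real.log (1 / δ) ^ 3)

end

end TDZero

/-!
# Convergence rate of TD(0) with step sizes `1 / (n + 1)`

The error `y n = θ n - θ*` obeys `y (n + 1) = y n + g n / (n + 1)`, where the mean of `g n` given
the past is `-A (y n)`. Since the spectrum of `A` lies in `{Re > lam}`, the matrix `A` is coercive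
with constant `lam` for an equivalent Hilbert norm `‖J y‖` (`exists_lyapunov`, by Gelfand's formula
for `1 - η A`). Moreover `lam < 1 / 2` (`lam_lt_half`), because the features are bounded by `1 / 2`;
this makes the noise square-summable after the rescaling below.

From a time `m` on, put `w n = ((n + 1) / (m + 1)) ^ lam` and `X n = (w n) ^ 2 ‖J (y n)‖ ^ 2 + 1`.
The growth of the weight is compensated by the coercivity, so the relative increments of `X` are
centred up to an error of order `β ^ 2` and bounded by a multiple of `β`, where `β = w n / (n + 1)`.
They raise the `q`-th moment of `X` by a factor of at most `exp (const * q ^ 2 * β ^ 2)` as long as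
`q β` is small (`lintegral_step_le`). Since `β ≤ 1 / (m + 1)` and the sum of all `β ^ 2` is of order
`1 / (m + 1)`, with `m` proportional to `q` the total factor is `exp (O(q))`, and Ville's inequality
(`ville_inequality`) gives `X n ≤ const * X m` for all `n ≥ m` with probability at least
`1 - exp (-q)`.

The iterates grow at most linearly whatever the data (`norm_iterate_add_one_le`), so `X m` is of
order `m ^ 2`, and the error is of order `m ^ (1 + lam) / n ^ lam` (`iterate_concentration`). With
`q` the integer above `log (1 / δ)`, this is at most `ε` once `n` exceeds a constant times
`(1 / ε) ^ (1 / lam) * log (1 / δ) ^ (1 + 1 / lam)`, which the first term of the rate dominates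
without any logarithmic factor (`isSoftO_waitingTime`).
-/

namespace TDZero

/-! ### A Lyapunov norm for a matrix with spectrum in a half-plane -/

/-- An operator whose `K`-th power contracts by `ρ ^ K` contracts by `ρ` in an equivalent Hilbert
norm, namely the norm of the orbit `x, ρ⁻¹ T x, …, ρ^{-(K-1)} T^{K-1} x`. -/
theorem exists_orbit_embedding {E : Type*} [NormedAddCommGroup E] [InnerProductSpace ℝ E]
    (T : E →L[ℝ] E) {ρ : ℝ} (hρ : 0 < ρ) {K : ℕ} (hK : 0 < K)
    (h : ∀ x, ‖(T ^ K) x‖ ≤ ρ ^ K * ‖x‖) :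
    ∃ J : E →L[ℝ] PiLp 2 (fun _ : Fin K => E),
      (∀ x, ‖x‖ ≤ ‖J x‖) ∧ ∀ x, ‖J (T x)‖ ^ 2 ≤ ρ ^ 2 * ‖J x‖ ^ 2 := by
  let J : E →L[ℝ] PiLp 2 (fun _ : Fin K => E) :=
    ((PiLp.continuousLinearEquiv 2 ℝ (fun _ : Fin K => E)).symm : _ →L[ℝ] _).comp
      (ContinuousLinearMap.pi fun k : Fin K => (ρ⁻¹ ^ (k : ℕ)) • T ^ (k : ℕ))
  have hJ : ∀ x, ‖J x‖ ^ 2 = ∑ k ∈ Finset.range K, ‖(ρ⁻¹ ^ k) • (T ^ k) x‖ ^ 2 := by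
    intro x
    rw [PiLp.norm_sq_eq_of_L2, Finset.sum_range]
    rfl
  refine ⟨J, fun x => ?_, fun x => ?_⟩
  · refine le_of_sq_le_sq ?_ (norm_nonneg _)
    rw [hJ]
    have := Finset.single_le_sum (f := fun k => ‖(ρ⁻¹ ^ k) • (T ^ k) x‖ ^ 2)
      (fun i _ => by positivity) (Finset.mem_range.2 hK)
    simpa using this
  · obtain ⟨K, rfl⟩ : ∃ k, K = k + 1 := ⟨K - 1, by omega⟩
    have hstep : ∀ k, ‖(ρ⁻¹ ^ k) • (T ^ k) (T x)‖ ^ 2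
        = ρ ^ 2 * ‖(ρ⁻¹ ^ (k + 1)) • (T ^ (k + 1)) x‖ ^ 2 := by
      intro k
      rw [pow_succ T k, norm_smul, norm_smul, mul_apply_eq_comp]
      simp only [norm_pow, norm_inv, Real.norm_eq_abs, abs_of_pos hρ]
      rw [pow_succ ρ⁻¹ k]
      field_simp
    have hlast : ‖(ρ⁻¹ ^ (K + 1)) • (T ^ (K + 1)) x‖ ^ 2 ≤ ‖x‖ ^ 2 := by
      refine pow_le_pow_left₀ (norm_nonneg _) ?_ 2
      rw [norm_smul]
      simp only [norm_pow, norm_inv, Real.norm_eq_abs, abs_of_pos hρ]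
      rw [inv_pow, inv_mul_le_iff₀ (by positivity)]
      exact h x
    rw [hJ, hJ]
    simp_rw [hstep]
    rw [← Finset.mul_sum, Finset.sum_range_succ, Finset.sum_range_succ' (n := K)]
    refine mul_le_mul_of_nonneg_left (add_le_add le_rfl (hlast.trans_eq ?_)) (sq_nonneg ρ)
    simp

/-- The coordinatewise inclusion `ℝ^d → ℂ^d`. -/
noncomputable def complexify {d : ℕ} (x : Vec d) : EuclideanSpace ℂ (Fin d) :=
  WithLp.toLp 2 fun i => (x i : ℂ)

theorem norm_complexify {d : ℕ} (x : Vec d) : ‖complexify x‖ = ‖x‖ := by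
  simp [EuclideanSpace.norm_eq, complexify]

theorem toEuclideanCLM_complexify {d : ℕ} (B : Matrix (Fin d) (Fin d) ℝ) (x : Vec d) :
    Matrix.toEuclideanCLM (𝕜 := ℂ) (B.map Complex.ofReal) (complexify x)
      = complexify (Matrix.toEuclideanCLM (𝕜 := ℝ) B x) := by
  ext i
  simp [complexify, Matrix.mulVec, dotProduct]

theorem toEuclideanCLM_pow_complexify {d : ℕ} (B : Matrix (Fin d) (Fin d) ℝ) (k : ℕ) (x : Vec d) :
    (Matrix.toEuclideanCLM (𝕜 := ℂ) (B.map Complex.ofReal) ^ k) (complexify x)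
      = complexify ((Matrix.toEuclideanCLM (𝕜 := ℝ) B ^ k) x) := by
  induction k generalizing x with
  | zero => simp
  | succ k ih =>
    rw [pow_succ, pow_succ, mul_apply_eq_comp, mul_apply_eq_comp,
      toEuclideanCLM_complexify, ih]

/-- Gelfand's formula, read on real vectors. -/
theorem exists_pow_contraction {d : ℕ} [NeZero d] (B : Matrix (Fin d) (Fin d) ℝ) {ρ : ℝ}
    (hρ : 0 < ρ) (h : ∀ μ ∈ spectrum ℂ (B.map Complex.ofReal), ‖μ‖ < ρ) :
    ∃ K : ℕ, 0 < K ∧ ∀ x, ‖(Matrix.toEuclideanCLM (𝕜 := ℝ) B ^ K) x‖ ≤ ρ ^ K * ‖x‖ := by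
  set a := Matrix.toEuclideanCLM (𝕜 := ℂ) (B.map Complex.ofReal) with ha
  have hspec : spectrum ℂ a = spectrum ℂ (B.map Complex.ofReal) :=
    AlgEquiv.spectrum_eq (Matrix.toEuclideanCLM (n := Fin d) (𝕜 := ℂ)) (B.map Complex.ofReal)
  have hlt : spectralRadius ℂ a < (ρ.toNNReal : ℝ≥0∞) := by
    refine spectrum.spectralRadius_lt_of_forall_lt a fun z hz => ?_
    rw [← NNReal.coe_lt_coe, coe_nnnorm, Real.coe_toNNReal _ hρ.le]
    exact h z (hspec ▸ hz)
  have hev :=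
    (spectrum.pow_nnnorm_pow_one_div_tendsto_nhds_spectralRadius a).eventually_lt_const hlt
  obtain ⟨K, hK, hK0⟩ := (hev.and (Filter.eventually_gt_atTop 0)).exists
  refine ⟨K, hK0, fun x => ?_⟩
  have hpow : ‖a ^ K‖ ≤ ρ ^ K := by
    have h1 : (‖a ^ K‖₊ : ℝ≥0∞) ≤ (ρ.toNNReal : ℝ≥0∞) ^ (K : ℝ) := by
      rw [one_div] at hK
      exact (ENNReal.rpow_inv_le_iff (by exact_mod_cast hK0)).1 hK.le
    rw [ENNReal.rpow_natCast] at h1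
    have h2 : ‖a ^ K‖₊ ≤ ρ.toNNReal ^ K := by exact_mod_cast h1
    have h3 : ((‖a ^ K‖₊ : NNReal) : ℝ) ≤ ((ρ.toNNReal ^ K : NNReal) : ℝ) := by exact_mod_cast h2
    simpa [Real.coe_toNNReal _ hρ.le] using h3
  rw [← norm_complexify, ← norm_complexify x, ← toEuclideanCLM_pow_complexify]
  exact ((a ^ K).le_opNorm _).trans (by gcongr)

/-- If the eigenvalues of `A` have real part above `lam`, then `A` is coercive with constant `lam`
for an equivalent Hilbert norm `x ↦ ‖J x‖`: for small `η` the spectral radius of `1 - η A` is below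
`(1 - 2 η lam)^{1/2}`, and the norm adapted to `1 - η A` works. -/
theorem exists_lyapunov {d : ℕ} [NeZero d] (A : Matrix (Fin d) (Fin d) ℝ) {lam : ℝ}
    (hlam_pos : 0 < lam)
    (hlam : ∀ μ ∈ spectrum ℂ (A.map Complex.ofReal), lam < μ.re) :
    ∃ (K : ℕ) (J : Vec d →L[ℝ] PiLp 2 (fun _ : Fin K => Vec d)), (∀ x, ‖x‖ ≤ ‖J x‖) ∧
      ∀ x, lam * ‖J x‖ ^ 2 ≤ inner ℝ (J x) (J (Matrix.toEuclideanCLM (𝕜 := ℝ) A x)) := by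
  have hev : ∀ᶠ η : ℝ in nhdsWithin 0 (Ioi 0), ∀ μ ∈ spectrum ℂ (A.map Complex.ofReal),
      η * ‖μ‖ ^ 2 < 2 * (μ.re - lam) := by
    rw [Filter.eventually_all_finite (Matrix.finite_spectrum _)]
    intro μ hμ
    have : Filter.Tendsto (fun η : ℝ => η * ‖μ‖ ^ 2) (nhdsWithin 0 (Ioi 0)) (nhds (0 * ‖μ‖ ^ 2)) :=
      (Filter.Tendsto.mul_const _ Filter.tendsto_id).mono_left nhdsWithin_le_nhds
    refine this.eventually_lt_const ?_
    have := hlam μ hμ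
    linarith
  have hev2 : ∀ᶠ η : ℝ in nhdsWithin 0 (Ioi 0), η < 1 / (2 * lam) :=
    nhdsWithin_le_nhds (Iio_mem_nhds (by positivity))
  obtain ⟨η, ⟨h1, h2⟩, hη⟩ := ((hev.and hev2).and self_mem_nhdsWithin).exists
  have hη : 0 < η := hη
  have hr : 0 < 1 - 2 * η * lam := by
    rw [lt_div_iff₀ (by positivity)] at h2
    linarith
  set B := 1 - η • A with hB
  have hBC : B.map Complex.ofReal = 1 - (η : ℂ) • A.map Complex.ofReal := by
    ext i j
    by_cases hij : i = j <;> simp [hB, hij]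
  have hspecB : ∀ μ ∈ spectrum ℂ (B.map Complex.ofReal), ‖μ‖ < √(1 - 2 * η * lam) := by
    intro μ hμ
    have hη0 : (η : ℂ) ≠ 0 := by exact_mod_cast hη.ne'
    have hmem : (1 - μ) / η ∈ spectrum ℂ (A.map Complex.ofReal) := by
      rw [spectrum.mem_iff] at hμ ⊢
      contrapose! hμ
      have : algebraMap ℂ (Matrix (Fin d) (Fin d) ℂ) μ - B.map Complex.ofReal
          = -((Units.mk0 (η : ℂ) hη0) • (algebraMap ℂ (Matrix (Fin d) (Fin d) ℂ) ((1 - μ) / η)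
            - A.map Complex.ofReal)) := by
        rw [hBC, Units.smul_def, Units.val_mk0, smul_sub, Algebra.algebraMap_eq_smul_one,
          Algebra.algebraMap_eq_smul_one, smul_smul, mul_div_cancel₀ _ hη0, sub_smul, one_smul]
        abel
      rw [this]
      exact (hμ.smul _).neg
    set ξ := (1 - μ) / (η : ℂ) with hξ
    have hμξ : μ = 1 - η * ξ := by
      rw [hξ, mul_div_cancel₀ _ hη0]; ring
    refine Real.lt_sqrt_of_sq_lt ?_
    have h3 := h1 ξ hmem
    have h4 : ‖μ‖ ^ 2 = 1 - 2 * η * ξ.re + η ^ 2 * ‖ξ‖ ^ 2 := by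
      rw [hμξ, Complex.sq_norm, Complex.sq_norm, Complex.normSq_apply, Complex.normSq_apply]
      simp
      ring
    rw [h4]
    nlinarith
  have hsq := Real.sq_sqrt hr.le
  obtain ⟨K, hK, hc⟩ := exists_pow_contraction B (Real.sqrt_pos.2 hr) hspecB
  obtain ⟨J, hJ1, hJ2⟩ := exists_orbit_embedding _ (Real.sqrt_pos.2 hr) hK hc
  refine ⟨K, J, hJ1, fun x => ?_⟩
  have h5 := hJ2 x
  have h6 : Matrix.toEuclideanCLM (𝕜 := ℝ) B x = x - η • Matrix.toEuclideanCLM (𝕜 := ℝ) A x := by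
    rw [hB, map_sub, map_one, map_smul]
    rfl
  rw [h6, map_sub, map_smul, norm_sub_sq_real, inner_smul_right, hsq] at h5
  have h7 := sq_nonneg ‖η • J (Matrix.toEuclideanCLM (𝕜 := ℝ) A x)‖
  have h8 : 2 * η * (lam * ‖J x‖ ^ 2)
      ≤ 2 * η * inner ℝ (J x) (J (Matrix.toEuclideanCLM (𝕜 := ℝ) A x)) := by linarith
  exact le_of_mul_le_mul_left h8 (by positivity)

/-! ### A maximal inequality for Markov recursions -/

/-- The sigma-algebra generated by `Z 0, …, Z (n - 1)`. -/
abbrev past {Ω E : Type*} [MeasurableSpace E] (Z : ℕ → Ω → E) (n : ℕ) : MeasurableSpace Ω :=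
  ⨆ i ∈ Iio n, MeasurableSpace.comap (Z i) inferInstance

theorem past_le {Ω E : Type*} [MeasurableSpace Ω] [MeasurableSpace E] {Z : ℕ → Ω → E}
    (hZ : ∀ n, Measurable (Z n)) (n : ℕ) : past Z n ≤ ‹MeasurableSpace Ω› :=
  iSup₂_le fun i _ => (hZ i).comap_le

theorem past_mono {Ω E : Type*} [MeasurableSpace E] (Z : ℕ → Ω → E) {m n : ℕ} (h : m ≤ n) :
    past Z m ≤ past Z n :=
  biSup_mono fun _ hi => lt_of_lt_of_le hi h

theorem measurable_past {Ω E : Type*} [MeasurableSpace E] (Z : ℕ → Ω → E) {i n : ℕ} (h : i < n) :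
    Measurable[past Z n] (Z i) :=
  Measurable.mono (comap_measurable (Z i))
    (le_iSup₂_of_le (f := fun i (_ : i ∈ Iio n) => MeasurableSpace.comap (Z i) inferInstance)
      i h le_rfl) le_rfl

theorem indepFun_of_measurable_past {Ω E : Type*} [MeasurableSpace Ω] [MeasurableSpace E]
    {Pr : Measure Ω} {ρ : Measure E} {Z : ℕ → Ω → E} (hZ : IsIIDSample Pr ρ Z) {n : ℕ} {Y : Type*}
    [MeasurableSpace Y] {W : Ω → Y} (hW : Measurable[past Z n] W) : IndepFun W (Z n) Pr := by
  have h := indep_iSup_of_disjoint (fun i => (hZ.measurable i).comap_le) hZ.indep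
    (S := Iio n) (T := {n}) (by simp)
  rw [IndepFun_iff_Indep]
  refine indep_of_indep_of_le_left (indep_of_indep_of_le_right h ?_) hW.comap_le
  exact le_iSup₂_of_le (f := fun i (_ : i ∈ ({n} : Set ℕ)) =>
    MeasurableSpace.comap (Z i) inferInstance) n rfl le_rfl

/-- On an event of the past, the next value of `Φ` is on average at most the current one. -/
theorem setLIntegral_step_le {Ω E X : Type*} [MeasurableSpace Ω] [MeasurableSpace E]
    [MeasurableSpace X] {Pr : Measure Ω} {ρ : Measure E} {Z : ℕ → Ω → E}
    [IsProbabilityMeasure Pr] (hZ : IsIIDSample Pr ρ Z) {n : ℕ}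
    {x : Ω → X} (hx : Measurable[past Z n] x) {A : Set Ω} (hA : MeasurableSet[past Z n] A)
    {T : X → E → X} (hT : Measurable (Function.uncurry T))
    {Φ Φ' : X → ℝ≥0∞} (hΦ' : Measurable Φ')
    (h : ∀ y, ∫⁻ z, Φ' (T y z) ∂ρ ≤ Φ y) :
    ∫⁻ ω in A, Φ' (T (x ω) (Z n ω)) ∂Pr ≤ ∫⁻ ω in A, Φ (x ω) ∂Pr := by
  have hle := past_le hZ.measurable n
  have hA' : MeasurableSet A := hle _ hA
  have hW : Measurable[past Z n] (fun ω => (x ω, A.indicator (1 : Ω → ℝ≥0∞) ω)) :=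
    Measurable.prodMk hx (Measurable.indicator (measurable_const (a := (1 : ℝ≥0∞))) hA)
  have hWm : Measurable (fun ω => (x ω, A.indicator (1 : Ω → ℝ≥0∞) ω)) := hW.mono hle le_rfl
  have hind := indepFun_of_measurable_past hZ hW
  rw [indepFun_iff_map_prod_eq_prod_map_map hWm.aemeasurable (hZ.measurable n).aemeasurable,
    hZ.law n] at hind
  have : IsProbabilityMeasure ρ := by
    rw [← hZ.law n]; exact Measure.isProbabilityMeasure_map (hZ.measurable n).aemeasurable
  have hTm : Measurable fun p : (X × ℝ≥0∞) × E => p.1.2 * Φ' (T p.1.1 p.2) :=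
    measurable_fst.snd.mul (hΦ'.comp (hT.comp (measurable_fst.fst.prodMk measurable_snd)))
  calc ∫⁻ ω in A, Φ' (T (x ω) (Z n ω)) ∂Pr
      = ∫⁻ ω, A.indicator (1 : Ω → ℝ≥0∞) ω * Φ' (T (x ω) (Z n ω)) ∂Pr := by
        rw [← lintegral_indicator hA']
        congr 1 with ω
        by_cases hω : ω ∈ A <;> simp [hω]
    _ = ∫⁻ p, p.1.2 * Φ' (T p.1.1 p.2)
          ∂(Pr.map fun ω => ((x ω, A.indicator (1 : Ω → ℝ≥0∞) ω), Z n ω)) := by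
        rw [lintegral_map hTm (hWm.prodMk (hZ.measurable n))]
    _ = ∫⁻ w, w.2 * ∫⁻ z, Φ' (T w.1 z) ∂ρ
          ∂(Pr.map fun ω => (x ω, A.indicator (1 : Ω → ℝ≥0∞) ω)) := by
        rw [hind, lintegral_prod _ hTm.aemeasurable]
        congr 1 with w
        exact lintegral_const_mul w.2 (f := fun z => Φ' (T w.1 z))
          (hΦ'.comp (hT.comp measurable_prodMk_left))
    _ = ∫⁻ ω, A.indicator (1 : Ω → ℝ≥0∞) ω * ∫⁻ z, Φ' (T (x ω) z) ∂ρ ∂Pr := by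
        rw [lintegral_map _ hWm]
        exact measurable_snd.mul
          ((hΦ'.comp hT).lintegral_prod_right'.comp measurable_fst)
    _ ≤ ∫⁻ ω, A.indicator (1 : Ω → ℝ≥0∞) ω * Φ (x ω) ∂Pr := by
        gcongr with ω
        exact h _
    _ = ∫⁻ ω in A, Φ (x ω) ∂Pr := by
        rw [← lintegral_indicator hA']
        congr 1 with ω
        by_cases hω : ω ∈ A <;> simp [hω]

/-- Ville's inequality: if `Φ` is a nonnegative supermartingale from time `m` on along the
recursion `x (n + 1) = T n (x n) (Z n)` driven by independent noise, then it ever reaches the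
level `B` after time `m` with probability at most `𝔼[Φ m (x m)] / B`. -/
theorem ville_inequality {Ω E X : Type*} [MeasurableSpace Ω] [MeasurableSpace E]
    [MeasurableSpace X] {Pr : Measure Ω} {ρ : Measure E} {Z : ℕ → Ω → E}
    [IsProbabilityMeasure Pr] (hZ : IsIIDSample Pr ρ Z)
    {x : ℕ → Ω → X} {x₀ : X} (hx0 : ∀ ω, x 0 ω = x₀)
    {T : ℕ → X → E → X} (hT : ∀ n, Measurable (Function.uncurry (T n)))
    (hx : ∀ n ω, x (n + 1) ω = T n (x n ω) (Z n ω))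
    {Φ : ℕ → X → ℝ≥0∞} (hΦ : ∀ n, Measurable (Φ n)) {m : ℕ}
    (h : ∀ n, m ≤ n → ∀ y, ∫⁻ z, Φ (n + 1) (T n y z) ∂ρ ≤ Φ n y) (B : ℝ≥0∞) :
    B * Pr {ω | ∃ n, m ≤ n ∧ B ≤ Φ n (x n ω)} ≤ ∫⁻ ω, Φ m (x m ω) ∂Pr := by
  have hxm : ∀ n, Measurable[past Z n] (x n) := by
    intro n
    induction n with
    | zero =>
      rw [show x 0 = fun _ => x₀ from funext hx0]
      exact measurable_const
    | succ n ih =>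
      rw [show x (n + 1) = fun ω => Function.uncurry (T n) (x n ω, Z n ω) from funext (hx n)]
      exact (hT n).comp ((ih.mono (past_mono Z n.le_succ) le_rfl).prodMk
        (measurable_past Z n.lt_succ_self))
  -- the event that the level has not been reached before time `n`
  let A : ℕ → Set Ω := fun n => {ω | ∀ k, m ≤ k → k < n → Φ k (x k ω) < B}
  have hAm : ∀ n, MeasurableSet[past Z n] (A n) := by
    intro n
    have hA_eq : A n = ⋂ k, ⋂ (_ : m ≤ k), ⋂ (_ : k < n), {ω | Φ k (x k ω) < B} := by
      ext ω; simp [A]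
    rw [hA_eq]
    refine MeasurableSet.iInter fun k => MeasurableSet.iInter fun _ => MeasurableSet.iInter
      fun hk => ?_
    exact past_mono Z hk.le _ (((hΦ k).comp (hxm k)) measurableSet_Iio)
  have hAm' : ∀ n, MeasurableSet (A n) := fun n => past_le hZ.measurable n _ (hAm n)
  have hsub : ∀ n, A (n + 1) ⊆ A n := fun n ω hω k hk hkn => hω k hk (by omega)
  have hkey : ∀ n, m ≤ n →
      B * Pr (A n)ᶜ + ∫⁻ ω in A n, Φ n (x n ω) ∂Pr ≤ ∫⁻ ω, Φ m (x m ω) ∂Pr := by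
    intro n hn
    induction n, hn using Nat.le_induction with
    | base =>
      have : A m = univ := by
        ext ω; simp only [A, mem_ofPred_eq, mem_univ, iff_true]; intro k h1 h2; omega
      simp [this]
    | succ n hn ih =>
      refine le_trans ?_ ih
      have hAn1 : MeasurableSet[past Z n] (A (n + 1)) := by
        have : A (n + 1) = A n ∩ {ω | Φ n (x n ω) < B} := by
          ext ω
          simp only [A, mem_ofPred_eq, mem_inter_iff]
          constructor
          · exact fun h => ⟨fun k h1 h2 => h k h1 (by omega), h n hn (by omega)⟩
          · rintro ⟨h1, h2⟩ k hk hkn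
            rcases Nat.lt_succ_iff_lt_or_eq.1 hkn with h3 | rfl
            · exact h1 k hk h3
            · exact h2
        rw [this]
        exact (hAm n).inter (((hΦ n).comp (hxm n)) measurableSet_Iio)
      have h1 : ∫⁻ ω in A (n + 1), Φ (n + 1) (x (n + 1) ω) ∂Pr
          ≤ ∫⁻ ω in A (n + 1), Φ n (x n ω) ∂Pr := by
        simp_rw [hx n]
        exact setLIntegral_step_le hZ (hxm n) hAn1 (hT n) (hΦ (n + 1)) (h n hn)
      have h2 : B * Pr (A n \ A (n + 1)) ≤ ∫⁻ ω in A n \ A (n + 1), Φ n (x n ω) ∂Pr := by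
        rw [← setLIntegral_const]
        refine setLIntegral_mono' ((hAm' n).diff (hAm' (n + 1))) fun ω hω => ?_
        by_contra hlt
        refine hω.2 fun k hk hkn => ?_
        rcases Nat.lt_succ_iff_lt_or_eq.1 hkn with h3 | rfl
        · exact hω.1 k hk h3
        · exact not_le.1 hlt
      have h3 : (A (n + 1))ᶜ = (A n)ᶜ ∪ (A n \ A (n + 1)) := by
        ext ω
        have := @hsub n ω
        simp only [mem_compl_iff, mem_union, mem_sdiff]
        tauto
      have h4 : Pr (A (n + 1))ᶜ ≤ Pr (A n)ᶜ + Pr (A n \ A (n + 1)) := h3 ▸ measure_union_le _ _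
      have h5 : ∫⁻ ω in A n, Φ n (x n ω) ∂Pr = ∫⁻ ω in A (n + 1), Φ n (x n ω) ∂Pr
          + ∫⁻ ω in A n \ A (n + 1), Φ n (x n ω) ∂Pr := by
        rw [← lintegral_inter_add_sdiff _ (A n) (hAm' (n + 1)),
          inter_eq_self_of_subset_right (hsub n)]
      calc B * Pr (A (n + 1))ᶜ + ∫⁻ ω in A (n + 1), Φ (n + 1) (x (n + 1) ω) ∂Pr
          ≤ B * (Pr (A n)ᶜ + Pr (A n \ A (n + 1))) + ∫⁻ ω in A (n + 1), Φ n (x n ω) ∂Pr := by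
            gcongr
        _ = B * Pr (A n)ᶜ + (∫⁻ ω in A (n + 1), Φ n (x n ω) ∂Pr
            + B * Pr (A n \ A (n + 1))) := by ring
        _ ≤ _ := by rw [h5]; gcongr
  have hset : {ω | ∃ n, m ≤ n ∧ B ≤ Φ n (x n ω)} = ⋃ n, (A n)ᶜ := by
    ext ω
    simp only [mem_ofPred_eq, mem_iUnion, mem_compl_iff, A, not_forall, not_lt]
    constructor
    · rintro ⟨n, h1, h2⟩
      exact ⟨n + 1, n, h1, by omega, h2⟩
    · rintro ⟨_, n, h1, _, h2⟩
      exact ⟨n, h1, h2⟩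
  have hmono : Monotone fun n => (A n)ᶜ :=
    monotone_nat_of_le_succ fun n => compl_subset_compl.2 (hsub n)
  rw [hset, hmono.measure_iUnion, ENNReal.mul_iSup]
  refine iSup_le fun n => ?_
  calc B * Pr (A n)ᶜ ≤ B * Pr (A (max m n))ᶜ := by
        exact mul_le_mul_right (measure_mono (hmono (le_max_right m n))) B
    _ ≤ _ := le_self_add
    _ ≤ _ := hkey _ (le_max_left m n)

/-! ### Moments of one step of a stochastic approximation -/

/-- A relative increment `R + c`, with `R` centred and bounded by `r`, multiplies the `q`-th moment
by at most `exp (q c + q² r²)`, as long as `q r ≤ 1`. -/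
theorem lintegral_pow_le_exp {E : Type*} [MeasurableSpace E] {ρ : Measure E}
    [IsProbabilityMeasure ρ] {Y R : E → ℝ} {X c r : ℝ} {q : ℕ} (hX : 0 ≤ X)
    (hY0 : ∀ z, 0 ≤ Y z) (hY : ∀ᵐ z ∂ρ, Y z ≤ X * (1 + R z + c))
    (hR : ∀ᵐ z ∂ρ, |R z| ≤ r) (hRm : AEStronglyMeasurable R ρ) (hR0 : ∫ z, R z ∂ρ = 0)
    (hqr : q * r ≤ 1) :
    ∫⁻ z, ENNReal.ofReal (Y z ^ q) ∂ρ
      ≤ ENNReal.ofReal (X ^ q * Real.exp (q * c + q ^ 2 * r ^ 2)) := by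
  have hRi : Integrable R ρ := Integrable.of_bound hRm r hR
  set H : E → ℝ := fun z => X ^ q * Real.exp (q * c) * (1 + q * R z + q ^ 2 * r ^ 2) with hH
  have hpt : ∀ᵐ z ∂ρ, Y z ^ q ≤ H z := by
    filter_upwards [hY, hR] with z hz hr
    have hqR : |q * R z| ≤ 1 := by
      rw [abs_mul, Nat.abs_cast]
      exact (mul_le_mul_of_nonneg_left hr (Nat.cast_nonneg q)).trans hqr
    have h1 : Y z ≤ X * Real.exp (R z + c) := by
      refine hz.trans (mul_le_mul_of_nonneg_left ?_ hX)
      linarith [Real.add_one_le_exp (R z + c)]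
    have h2 : Real.exp (q * R z) ≤ 1 + q * R z + q ^ 2 * r ^ 2 := by
      have h3 := (abs_le.1 (Real.abs_exp_sub_one_sub_id_le hqR)).2
      have h4 : (q * R z) ^ 2 ≤ q ^ 2 * r ^ 2 := by
        rw [mul_pow]
        exact mul_le_mul_of_nonneg_left (sq_le_sq' (abs_le.1 hr).1 (abs_le.1 hr).2) (sq_nonneg _)
      linarith
    calc Y z ^ q ≤ (X * Real.exp (R z + c)) ^ q := by gcongr; exact hY0 z
      _ = X ^ q * Real.exp (q * c) * Real.exp (q * R z) := by
        rw [mul_pow, ← Real.exp_nat_mul, mul_assoc, ← Real.exp_add]; ring_nf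
      _ ≤ H z := mul_le_mul_of_nonneg_left h2 (by positivity)
  have hRq : Integrable (fun z => 1 + q * R z) ρ := (integrable_const _).add (hRi.const_mul _)
  have hHi : Integrable H ρ := (hRq.add (integrable_const _)).const_mul _
  have hHint : ∫ z, H z ∂ρ = X ^ q * Real.exp (q * c) * (1 + q ^ 2 * r ^ 2) := by
    rw [hH, integral_const_mul, integral_add hRq (integrable_const _),
      integral_add (integrable_const _) (hRi.const_mul _),
      integral_const_mul, hR0]
    simp
  calc ∫⁻ z, ENNReal.ofReal (Y z ^ q) ∂ρ ≤ ∫⁻ z, ENNReal.ofReal (H z) ∂ρ := by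
        refine lintegral_mono_ae ?_
        filter_upwards [hpt] with z hz using ENNReal.ofReal_le_ofReal hz
    _ = ENNReal.ofReal (∫ z, H z ∂ρ) := by
        rw [ofReal_integral_eq_lintegral_ofReal hHi]
        filter_upwards [hpt] with z hz using (pow_nonneg (hY0 z) q).trans hz
    _ ≤ _ := by
        rw [hHint]
        refine ENNReal.ofReal_le_ofReal ?_
        rw [Real.exp_add, mul_assoc]
        gcongr
        linarith [Real.add_one_le_exp ((q : ℝ) ^ 2 * r ^ 2)]

/-- One step `y ↦ y + α g` with a drift that is coercive in the norm `‖J ·‖` and with noise of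
linear growth. The weighted quantity `u² ‖J y‖² + 1` does not grow on average when the weight `u²`
grows by a factor of at most `1 + 2 α lam`, up to a second-order error `(α u)²`: the summand `1`
dominates the additive noise. -/
theorem lintegral_step_le {E V F : Type*} [MeasurableSpace E] {ρ : Measure E}
    [IsProbabilityMeasure ρ] [NormedAddCommGroup V] [NormedSpace ℝ V]
    [NormedAddCommGroup F] [InnerProductSpace ℝ F] (J : V →L[ℝ] F) (y : V) {g : E → V}
    {G lam α u u' : ℝ} {q : ℕ} (hG : 0 ≤ G) (hg : ∀ᵐ z ∂ρ, ‖J (g z)‖ ≤ G * (1 + ‖J y‖))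
    (hgm : AEStronglyMeasurable (fun z => (inner ℝ (J y) (J (g z)) : ℝ)) ρ)
    (hmean : ∫ z, (inner ℝ (J y) (J (g z)) : ℝ) ∂ρ ≤ -(lam * ‖J y‖ ^ 2))
    (hlam : 2 * lam ≤ 1) (hα0 : 0 ≤ α) (hα1 : α ≤ 1) (hu : 1 ≤ u)
    (huu : u' ^ 2 ≤ u ^ 2 * (1 + 2 * lam * α)) (hq : 1 ≤ q) (hqs : q * (16 * G * (α * u)) ≤ 1) :
    ∫⁻ z, ENNReal.ofReal ((u' ^ 2 * ‖J (y + α • g z)‖ ^ 2 + 1) ^ q) ∂ρ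
      ≤ ENNReal.ofReal ((u ^ 2 * ‖J y‖ ^ 2 + 1) ^ q
          * Real.exp (264 * G ^ 2 * q ^ 2 * (α * u) ^ 2)) := by
  set t := ‖J y‖ with ht
  have ht0 : 0 ≤ t := norm_nonneg _
  set f : E → ℝ := fun z => inner ℝ (J y) (J (g z)) with hf
  have hfb : ∀ᵐ z ∂ρ, ‖f z‖ ≤ G * (t + t ^ 2) := by
    filter_upwards [hg] with z hz
    calc ‖f z‖ ≤ ‖J y‖ * ‖J (g z)‖ := norm_inner_le_norm _ _
      _ ≤ t * (G * (1 + t)) := by gcongr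
      _ = _ := by ring
  have hfi : Integrable f ρ := Integrable.of_bound hgm _ hfb
  set e := ∫ z, f z ∂ρ with he
  have heb : |e| ≤ G * (t + t ^ 2) := by
    have := norm_integral_le_of_norm_le_const hfb
    simpa using this
  set X := u ^ 2 * t ^ 2 + 1 with hX
  have hX0 : 0 < X := by positivity
  have hu'2 : u' ^ 2 ≤ 2 * u ^ 2 := by
    have : 2 * lam * α ≤ 1 := mul_le_one₀ hlam hα0 hα1
    nlinarith
  -- the size of the noise relative to `X`, by the inequality of the two means
  have hrel : u ^ 2 * (t + t ^ 2) ≤ 2 * u * X := by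
    have h1 : 2 * (u * t) ≤ X := by rw [hX]; nlinarith [sq_nonneg (u * t - 1)]
    have h2 : u ^ 2 * t ^ 2 ≤ X := by rw [hX]; linarith
    nlinarith [mul_le_mul_of_nonneg_left h1 (by linarith : 0 ≤ u)]
  have main := lintegral_pow_le_exp (ρ := ρ) (q := q)
    (Y := fun z => u' ^ 2 * ‖J (y + α • g z)‖ ^ 2 + 1)
    (R := fun z => 2 * α * u' ^ 2 / X * (f z - e)) (X := X) (c := 8 * G ^ 2 * (α * u) ^ 2)
    (r := 16 * G * (α * u)) hX0.le (fun z => by positivity) ?_ ?_ ?_ ?_ hqs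
  · refine main.trans (ENNReal.ofReal_le_ofReal ?_)
    refine mul_le_mul_of_nonneg_left (Real.exp_le_exp.2 ?_) (by positivity)
    have hq1 : (1 : ℝ) ≤ q := by exact_mod_cast hq
    have : (q : ℝ) ≤ q ^ 2 := by nlinarith
    have h0 : 0 ≤ 8 * G ^ 2 * (α * u) ^ 2 := by positivity
    nlinarith [mul_le_mul_of_nonneg_right this h0]
  · filter_upwards [hg] with z hz
    have hexp : ‖J (y + α • g z)‖ ^ 2 = t ^ 2 + 2 * α * f z + α ^ 2 * ‖J (g z)‖ ^ 2 := by
      rw [map_add, map_smul, norm_add_sq_real, inner_smul_right, norm_smul, mul_pow,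
        Real.norm_eq_abs, sq_abs]
      ring
    have h1 : u' ^ 2 * (α ^ 2 * ‖J (g z)‖ ^ 2) ≤ X * (8 * G ^ 2 * (α * u) ^ 2) := by
      have h2 : ‖J (g z)‖ ^ 2 ≤ G ^ 2 * (2 * (1 + t ^ 2)) := by
        calc ‖J (g z)‖ ^ 2 ≤ (G * (1 + t)) ^ 2 := by gcongr
          _ = G ^ 2 * (1 + t) ^ 2 := by ring
          _ ≤ _ := by gcongr; nlinarith [sq_nonneg (1 - t)]
      have h3 : 1 + t ^ 2 ≤ 2 * X := by
        have : t ^ 2 ≤ u ^ 2 * t ^ 2 := le_mul_of_one_le_left (sq_nonneg t) (one_le_pow₀ hu)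
        rw [hX]
        nlinarith [sq_nonneg t]
      calc u' ^ 2 * (α ^ 2 * ‖J (g z)‖ ^ 2)
          ≤ 2 * u ^ 2 * (α ^ 2 * (G ^ 2 * (2 * (2 * X)))) := by gcongr; exact h2.trans (by gcongr)
        _ = _ := by ring
    have h4 : u' ^ 2 * (t ^ 2 + 2 * α * e) ≤ u ^ 2 * t ^ 2 := by
      have h5 : t ^ 2 + 2 * α * e ≤ (1 - 2 * lam * α) * t ^ 2 := by
        nlinarith [mul_le_mul_of_nonneg_left hmean hα0]
      have h6 : 0 ≤ (1 - 2 * lam * α) * t ^ 2 := by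
        have : 2 * lam * α ≤ 1 := mul_le_one₀ hlam hα0 hα1
        exact mul_nonneg (by linarith) (sq_nonneg t)
      calc u' ^ 2 * (t ^ 2 + 2 * α * e) ≤ u' ^ 2 * ((1 - 2 * lam * α) * t ^ 2) := by gcongr
        _ ≤ u ^ 2 * (1 + 2 * lam * α) * ((1 - 2 * lam * α) * t ^ 2) := by gcongr
        _ = u ^ 2 * t ^ 2 - (2 * lam * α) ^ 2 * (u ^ 2 * t ^ 2) := by ring
        _ ≤ _ := by
          have : 0 ≤ (2 * lam * α) ^ 2 * (u ^ 2 * t ^ 2) := by positivity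
          linarith
    have h7 : X * (2 * α * u' ^ 2 / X * (f z - e)) = 2 * α * u' ^ 2 * (f z - e) := by
      field_simp
    have h8 : X * (1 + 2 * α * u' ^ 2 / X * (f z - e) + 8 * G ^ 2 * (α * u) ^ 2)
        = X + 2 * α * u' ^ 2 * (f z - e) + X * (8 * G ^ 2 * (α * u) ^ 2) := by
      rw [← h7]; ring
    -- the mean part of the increment is paid for by `h4`, the second-order part by `h1`
    rw [hexp, h8, mul_add, mul_add]
    rw [mul_add] at h4
    linarith
  · filter_upwards [hfb] with z hz
    have h1 : |f z - e| ≤ 2 * (G * (t + t ^ 2)) := by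
      refine (abs_sub _ _).trans ?_
      rw [Real.norm_eq_abs] at hz
      linarith
    rw [abs_mul, abs_of_nonneg (by positivity), div_mul_eq_mul_div, div_le_iff₀ hX0]
    calc 2 * α * u' ^ 2 * |f z - e| ≤ 2 * α * (2 * u ^ 2) * (2 * (G * (t + t ^ 2))) := by gcongr
      _ = 8 * α * G * (u ^ 2 * (t + t ^ 2)) := by ring
      _ ≤ 8 * α * G * (2 * u * X) := by gcongr
      _ = _ := by ring
  · exact (hgm.sub aestronglyMeasurable_const).const_mul _
  · rw [integral_const_mul, integral_sub hfi (integrable_const _)]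
    simp [he]

/-! ### The temporal-difference field -/

/-- The increment direction `[r + γ φ'ᵀθ - φᵀθ] φ` of TD(0) at `θ` for the data `z = (φ, φ', r)`. -/
noncomputable def tdField {d : ℕ} (γ : ℝ) (θ : Vec d) (z : Vec d × Vec d × ℝ) : Vec d :=
  (z.2.2 + γ * inner ℝ z.2.1 θ - inner ℝ z.1 θ) • z.1

theorem iterate_succ {d : ℕ} (γ : ℝ) (α : ℕ → ℝ) (θ₀ : Vec d) (z : ℕ → Vec d × Vec d × ℝ) (n : ℕ) :
    iterate γ α θ₀ z (n + 1)
      = iterate γ α θ₀ z n + α n • tdField γ (iterate γ α θ₀ z n) (z n) := by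
  simp [iterate, tdField, smul_smul]

theorem measurable_tdField {d : ℕ} (γ : ℝ) :
    Measurable (Function.uncurry (tdField (d := d) γ)) := by
  unfold tdField Function.uncurry
  fun_prop

/-- The data obeying the bounds of `MDP.Bounded`. -/
def boundedData (d : ℕ) : Set (Vec d × Vec d × ℝ) :=
  {z | ‖z.1‖ ≤ 1 / 2 ∧ ‖z.2.1‖ ≤ 1 / 2 ∧ |z.2.2| ≤ 1}

theorem measurableSet_boundedData (d : ℕ) : MeasurableSet (boundedData d) :=
  have h1 : Measurable fun z : Vec d × Vec d × ℝ => ‖z.1‖ := by fun_prop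
  have h2 : Measurable fun z : Vec d × Vec d × ℝ => ‖z.2.1‖ := by fun_prop
  have h3 : Measurable fun z : Vec d × Vec d × ℝ => ‖z.2.2‖ := by fun_prop
  (measurableSet_le h1 measurable_const).inter
    ((measurableSet_le h2 measurable_const).inter (measurableSet_le h3 measurable_const))

theorem abs_inner_difference_le {d : ℕ} {γ : ℝ} (hγ0 : 0 ≤ γ) (hγ1 : γ ≤ 1) (θ : Vec d)
    {z : Vec d × Vec d × ℝ} (hz : z ∈ boundedData d) :
    |γ * inner ℝ z.2.1 θ - inner ℝ z.1 θ| ≤ ‖θ‖ := by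
  obtain ⟨h1, h2, -⟩ := hz
  have h3 := abs_real_inner_le_norm z.1 θ
  have h4 := abs_real_inner_le_norm z.2.1 θ
  have h5 := norm_nonneg θ
  calc |γ * inner ℝ z.2.1 θ - inner ℝ z.1 θ|
      ≤ |γ * inner ℝ z.2.1 θ| + |inner ℝ z.1 θ| := abs_sub _ _
    _ = γ * |inner ℝ z.2.1 θ| + |inner ℝ z.1 θ| := by rw [abs_mul, abs_of_nonneg hγ0]
    _ ≤ 1 * (1 / 2 * ‖θ‖) + 1 / 2 * ‖θ‖ := by
      gcongr
      · exact h4.trans (by gcongr)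
      · exact h3.trans (by gcongr)
    _ = ‖θ‖ := by ring

theorem norm_tdField_le {d : ℕ} {γ : ℝ} (hγ0 : 0 ≤ γ) (hγ1 : γ ≤ 1) (θ : Vec d)
    {z : Vec d × Vec d × ℝ} (hz : z ∈ boundedData d) : ‖tdField γ θ z‖ ≤ 1 + ‖θ‖ := by
  have h := abs_inner_difference_le hγ0 hγ1 θ hz
  obtain ⟨h1, h2, h3⟩ := hz
  rw [tdField, norm_smul, Real.norm_eq_abs, add_sub_assoc]
  have h4 := (abs_add_le z.2.2 (γ * inner ℝ z.2.1 θ - inner ℝ z.1 θ)).trans (add_le_add h3 h)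
  nlinarith [norm_nonneg z.1, norm_nonneg θ]

/-- Whatever the data, the iterates grow at most linearly. -/
theorem norm_iterate_add_one_le {d : ℕ} {γ : ℝ} (hγ0 : 0 ≤ γ) (hγ1 : γ ≤ 1) (θ₀ : Vec d)
    {z : ℕ → Vec d × Vec d × ℝ} (hz : ∀ n, z n ∈ boundedData d) (n : ℕ) :
    ‖iterate γ (fun n => ((n : ℝ) + 1)⁻¹) θ₀ z n‖ + 1 ≤ (‖θ₀‖ + 1) * (n + 1) := by
  induction n with
  | zero => simp [iterate]
  | succ n ih =>
    set θ := iterate γ (fun n => ((n : ℝ) + 1)⁻¹) θ₀ z n with hθ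
    rw [iterate_succ, ← hθ]
    have hn : (0 : ℝ) < n + 1 := by positivity
    calc ‖θ + ((n : ℝ) + 1)⁻¹ • tdField γ θ (z n)‖ + 1
        ≤ ‖θ‖ + ((n : ℝ) + 1)⁻¹ * (1 + ‖θ‖) + 1 := by
          grw [norm_add_le, norm_smul, norm_tdField_le hγ0 hγ1 θ (hz n)]
          rw [Real.norm_eq_abs, abs_of_pos (by positivity)]
      _ = (‖θ‖ + 1) * (1 + ((n : ℝ) + 1)⁻¹) := by ring
      _ ≤ (‖θ₀‖ + 1) * (n + 1) * (1 + ((n : ℝ) + 1)⁻¹) := by gcongr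
      _ = (‖θ₀‖ + 1) * (((n + 1 : ℕ) : ℝ) + 1) := by push_cast; field_simp

section

variable {S Act : Type*} [MeasurableSpace S] [MeasurableSpace Act] {d : ℕ}
  (M : MDP S Act) (π : Policy S Act) (ν : Measure S) (F : Features S d)

theorem measurable_sample :
    Measurable fun p : S × S => (F.φ p.1, F.φ p.2, M.reward p.1 (π.act p.1) p.2) := by
  have h1 := F.measurable_φ
  have h2 := π.measurable_act
  exact (h1.comp measurable_fst).prodMk ((h1.comp measurable_snd).prodMk
    (M.measurable_reward.comp
      (measurable_fst.prodMk ((h2.comp measurable_fst).prodMk measurable_snd))))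

variable {M F}

theorem ae_mem_boundedData (hbdd : M.Bounded F) :
    ∀ᵐ z ∂(M.sampleLaw π ν F), z ∈ boundedData d := by
  refine (ae_map_iff (p := fun z => z ∈ boundedData d) (measurable_sample M π F).aemeasurable
    (measurableSet_boundedData d)).2 ?_
  exact .of_forall fun p => ⟨hbdd.1 _, hbdd.1 _, hbdd.2 _ _ _⟩

variable (M F) [IsProbabilityMeasure ν]

instance isProbabilityMeasure_transitionLaw : IsProbabilityMeasure (M.transitionLaw π ν) :=
  inferInstanceAs (IsProbabilityMeasure (ν ⊗ₘ M.chain π))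

instance isProbabilityMeasure_sampleLaw : IsProbabilityMeasure (M.sampleLaw π ν F) :=
  Measure.isProbabilityMeasure_map (measurable_sample M π F).aemeasurable

variable {M F}

theorem integrable_reward_mul_feature (hbdd : M.Bounded F) (i : Fin d) :
    Integrable (fun p => M.reward p.1 (π.act p.1) p.2 * F.φ p.1 i) (M.transitionLaw π ν) := by
  have hm := measurable_sample M π F
  refine Integrable.of_bound (C := 1 * (1 / 2)) ?_ (.of_forall fun p => ?_)
  · have : Measurable fun z : Vec d × Vec d × ℝ => z.2.2 * z.1 i := by fun_prop
    exact (this.comp hm).aestronglyMeasurable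
  · rw [norm_mul]
    exact mul_le_mul (hbdd.2 _ _ _) ((PiLp.norm_apply_le _ _).trans (hbdd.1 _)) (norm_nonneg _)
      zero_le_one

theorem integrable_feature_mul_difference (hbdd : M.Bounded F) (i j : Fin d) :
    Integrable (fun p => F.φ p.1 i * (F.φ p.1 j - M.γ * F.φ p.2 j)) (M.transitionLaw π ν) := by
  have hm := measurable_sample M π F
  refine Integrable.of_bound (C := 1 / 2 * (1 / 2 + |M.γ| * (1 / 2))) ?_ (.of_forall fun p => ?_)
  · have : Measurable fun z : Vec d × Vec d × ℝ => z.1 i * (z.1 j - M.γ * z.2.1 j) := by fun_prop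
    exact (this.comp hm).aestronglyMeasurable
  · have h : ∀ s k, ‖F.φ s k‖ ≤ 1 / 2 := fun s k => (PiLp.norm_apply_le _ _).trans (hbdd.1 _)
    rw [norm_mul]
    gcongr
    · exact h _ _
    · refine (norm_sub_le _ _).trans (add_le_add (h _ _) ?_)
      rw [norm_mul, Real.norm_eq_abs]
      gcongr
      exact h _ _

/-- The mean of the temporal-difference field at `θ` is `b - A θ`. -/
theorem integral_inner_tdField (hbdd : M.Bounded F) (w θ : Vec d) :
    ∫ z, (inner ℝ w (tdField M.γ θ z) : ℝ) ∂(M.sampleLaw π ν F)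
      = inner ℝ w (WithLp.toLp 2 (M.b π ν F)
          - Matrix.toEuclideanCLM (𝕜 := ℝ) (M.A π ν F) θ) := by
  have hmeas : Measurable fun z : Vec d × Vec d × ℝ => (inner ℝ w (tdField M.γ θ z) : ℝ) := by
    unfold tdField
    fun_prop
  rw [MDP.sampleLaw, integral_map (measurable_sample M π F).aemeasurable
    hmeas.aestronglyMeasurable]
  have hexp : ∀ p : S × S,
      (inner ℝ w (tdField M.γ θ (F.φ p.1, F.φ p.2, M.reward p.1 (π.act p.1) p.2)) : ℝ)
        = ∑ i, w i * (M.reward p.1 (π.act p.1) p.2 * F.φ p.1 i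
            - ∑ j, F.φ p.1 i * (F.φ p.1 j - M.γ * F.φ p.2 j) * θ j) := by
    intro p
    have hγ : M.γ * inner ℝ (F.φ p.2) θ - inner ℝ (F.φ p.1) θ
        = -∑ j, (F.φ p.1 j - M.γ * F.φ p.2 j) * θ j := by
      simp only [PiLp.inner_apply, RCLike.inner_apply, conj_trivial, Finset.mul_sum]
      rw [← Finset.sum_sub_distrib, ← Finset.sum_neg_distrib]
      exact Finset.sum_congr rfl fun j _ => by ring
    rw [tdField, inner_smul_right, add_sub_assoc, hγ]
    simp only [PiLp.inner_apply, RCLike.inner_apply, conj_trivial]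
    rw [Finset.mul_sum]
    refine Finset.sum_congr rfl fun i _ => ?_
    simp_rw [mul_assoc (F.φ p.1 i), ← Finset.mul_sum]
    ring
  simp_rw [hexp]
  have hi1 := integrable_reward_mul_feature π ν hbdd
  have hi2 := integrable_feature_mul_difference π ν hbdd
  have hi3 : ∀ i, Integrable (fun p : S × S => ∑ j, F.φ p.1 i * (F.φ p.1 j - M.γ * F.φ p.2 j) * θ j)
      (M.transitionLaw π ν) := fun i =>
    integrable_finsetSum _ fun j _ => (hi2 i j).mul_const _
  have hi4 : ∀ i, Integrable (fun p : S × S => w i * (M.reward p.1 (π.act p.1) p.2 * F.φ p.1 i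
      - ∑ j, F.φ p.1 i * (F.φ p.1 j - M.γ * F.φ p.2 j) * θ j)) (M.transitionLaw π ν) :=
    fun i => ((hi1 i).sub (hi3 i)).const_mul _
  rw [integral_finsetSum _ fun i _ => hi4 i]
  rw [PiLp.inner_apply]
  refine Finset.sum_congr rfl fun i _ => ?_
  rw [integral_const_mul, integral_sub (hi1 i) (hi3 i),
    integral_finsetSum _ fun j _ => (hi2 i j).mul_const _]
  simp only [RCLike.inner_apply, conj_trivial]
  rw [mul_comm]
  congr 1
  simp [MDP.b, MDP.A, Matrix.mulVec, dotProduct, integral_mul_const]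

/-- Since the field is affine in `θ`, `xᵀ A x` is the mean of `xᵀ (g 0 - g x)`, where `g` denotes
the field; the bounds on the data apply to this difference pointwise. -/
theorem inner_A_le (hbdd : M.Bounded F) (x : Vec d) :
    inner ℝ x (Matrix.toEuclideanCLM (𝕜 := ℝ) (M.A π ν F) x) ≤ 1 / 2 * ‖x‖ ^ 2 := by
  have hint : ∀ θ, Integrable (fun z => (inner ℝ x (tdField M.γ θ z) : ℝ)) (M.sampleLaw π ν F) := by
    intro θ
    refine Integrable.of_bound (C := ‖x‖ * (1 + ‖θ‖)) ?_ ?_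
    · have : Measurable fun z : Vec d × Vec d × ℝ => (inner ℝ x (tdField M.γ θ z) : ℝ) := by
        unfold tdField
        fun_prop
      exact this.aestronglyMeasurable
    · filter_upwards [ae_mem_boundedData π ν hbdd] with z hz
      exact (norm_inner_le_norm _ _).trans (mul_le_mul_of_nonneg_left
        (norm_tdField_le M.γ_pos.le M.γ_lt_one.le θ hz) (norm_nonneg _))
  have h0 := integral_inner_tdField π ν hbdd x 0
  have hx := integral_inner_tdField π ν hbdd x x
  have hA : inner ℝ x (Matrix.toEuclideanCLM (𝕜 := ℝ) (M.A π ν F) x)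
      = ∫ z, (inner ℝ x (tdField M.γ 0 z) - inner ℝ x (tdField M.γ x z)) ∂(M.sampleLaw π ν F) := by
    rw [integral_sub (hint 0) (hint x), h0, hx, ← inner_sub_right]
    simp
  rw [hA]
  refine (le_abs_self _).trans ?_
  have hb : ∀ᵐ z ∂(M.sampleLaw π ν F),
      ‖inner ℝ x (tdField M.γ 0 z) - inner ℝ x (tdField M.γ x z)‖ ≤ 1 / 2 * ‖x‖ ^ 2 := by
    filter_upwards [ae_mem_boundedData π ν hbdd] with z hz
    have h1 := abs_inner_difference_le M.γ_pos.le M.γ_lt_one.le x hz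
    have h2 : tdField M.γ 0 z - tdField M.γ x z
        = (-(M.γ * inner ℝ z.2.1 x - inner ℝ z.1 x)) • z.1 := by
      rw [tdField, tdField, ← sub_smul]
      simp
      ring_nf
    rw [← inner_sub_right, h2]
    refine (norm_inner_le_norm _ _).trans ?_
    rw [norm_smul, norm_neg, Real.norm_eq_abs]
    calc ‖x‖ * (|M.γ * inner ℝ z.2.1 x - inner ℝ z.1 x| * ‖z.1‖) ≤ ‖x‖ * (‖x‖ * (1 / 2)) := by
          gcongr
          exact hz.1
      _ = _ := by ring
  have := norm_integral_le_of_norm_le_const hb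
  simpa using this

/-- Some eigenvalue of `A` has real part at most `1 / 2`, since `xᵀ A x ≤ ‖x‖² / 2`. -/
theorem lam_lt_half [NeZero d] (hbdd : M.Bounded F) {lam : ℝ}
    (hlam : ∀ μ ∈ spectrum ℂ ((M.A π ν F).map Complex.ofReal), lam < μ.re) : lam < 1 / 2 := by
  set A := M.A π ν F
  obtain ⟨μ, hμ⟩ := Module.End.exists_eigenvalue (Matrix.toLin' (A.map Complex.ofReal))
  have hmem : μ ∈ spectrum ℂ (A.map Complex.ofReal) := by
    rw [← Matrix.spectrum_toLin']
    exact Module.End.hasEigenvalue_iff_mem_spectrum.1 hμ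
  refine (hlam μ hmem).trans_le ?_
  obtain ⟨v, hv⟩ := hμ.exists_hasEigenvector
  have hv1 : (A.map Complex.ofReal).mulVec v = μ • v := by
    simpa using hv.apply_eq_smul
  set x : Vec d := WithLp.toLp 2 fun i => (v i).re with hx
  set y : Vec d := WithLp.toLp 2 fun i => (v i).im with hy
  have hAx : Matrix.toEuclideanCLM (𝕜 := ℝ) A x = μ.re • x - μ.im • y := by
    ext i
    have := congrArg Complex.re (congrFun hv1 i)
    simpa [hx, hy, Matrix.mulVec, dotProduct] using this
  have hAy : Matrix.toEuclideanCLM (𝕜 := ℝ) A y = μ.re • y + μ.im • x := by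
    ext i
    have := congrArg Complex.im (congrFun hv1 i)
    simpa [hx, hy, Matrix.mulVec, dotProduct] using this
  have h1 := inner_A_le π ν hbdd x
  have h2 := inner_A_le π ν hbdd y
  rw [hAx, inner_sub_right, inner_smul_right, inner_smul_right, real_inner_self_eq_norm_sq] at h1
  rw [hAy, inner_add_right, inner_smul_right, inner_smul_right, real_inner_self_eq_norm_sq,
    real_inner_comm] at h2
  have hpos : 0 < ‖x‖ ^ 2 + ‖y‖ ^ 2 := by
    by_contra hle
    have hx0 : x = 0 := norm_eq_zero.1 (by nlinarith [sq_nonneg ‖x‖, sq_nonneg ‖y‖])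
    have hy0 : y = 0 := norm_eq_zero.1 (by nlinarith [sq_nonneg ‖x‖, sq_nonneg ‖y‖])
    refine hv.2 (funext fun i => Complex.ext ?_ ?_)
    · simpa [hx] using congrArg (fun w : Vec d => w i) hx0
    · simpa [hy] using congrArg (fun w : Vec d => w i) hy0
  nlinarith

end

/-! ### Polynomial weights -/

theorem rpow_neg_div_le {a r : ℝ} (ha : 1 ≤ a) (hr0 : 0 < r) (hr1 : r ≤ 1) :
    a ^ (-r) / a ≤ 2 / r * (a ^ (-r) - (a + 1) ^ (-r)) := by
  have ha0 : 0 < a := by linarith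
  have h1 : (a + 1) ^ (-r) ≤ a ^ (-r) * (1 - r / (a + 1)) := by
    have h2 := rpow_one_add_le_one_add_mul_self (s := -(1 / (a + 1))) (p := r) (by
      rw [neg_le_neg_iff, div_le_one (by linarith)]; linarith) hr0.le hr1
    have h3 : 1 + -(1 / (a + 1)) = (a + 1)⁻¹ * a := by field_simp; ring
    rw [h3, Real.mul_rpow (by positivity) ha0.le, Real.inv_rpow (by positivity),
      ← Real.rpow_neg (by positivity)] at h2
    have h4 : (a + 1) ^ (-r) = a ^ (-r) * ((a + 1) ^ (-r) * a ^ r) := by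
      rw [mul_comm, mul_assoc, ← Real.rpow_add ha0]; simp
    rw [h4]
    refine mul_le_mul_of_nonneg_left (h2.trans_eq ?_) (by positivity)
    ring
  calc a ^ (-r) / a ≤ a ^ (-r) * (2 / (a + 1)) := by
        rw [div_eq_mul_inv]
        refine mul_le_mul_of_nonneg_left ?_ (by positivity)
        rw [inv_eq_one_div, div_le_div_iff₀ ha0 (by linarith)]
        linarith
    _ = 2 / r * (a ^ (-r) - a ^ (-r) * (1 - r / (a + 1))) := by field_simp; ring
    _ ≤ _ := by gcongr

/-- The weight that compensates the expected decay of the iterates from time `m` on. -/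
noncomputable def weight (lam : ℝ) (m n : ℕ) : ℝ := (((n : ℝ) + 1) / ((m : ℝ) + 1)) ^ lam

/-- A decreasing function of `n` that dominates the tail sums of
`(weight lam m n / (n + 1)) ^ 2`. -/
noncomputable def tailBound (lam : ℝ) (m n : ℕ) : ℝ :=
  2 / (1 - 2 * lam) * ((m : ℝ) + 1) ^ (-(2 * lam)) * ((n : ℝ) + 1) ^ (-(1 - 2 * lam))

theorem one_le_weight {lam : ℝ} (h0 : 0 ≤ lam) {m n : ℕ} (h : m ≤ n) : 1 ≤ weight lam m n := by
  refine Real.one_le_rpow ?_ h0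
  rw [one_le_div (by positivity)]
  gcongr

theorem weight_sq (lam : ℝ) (m n : ℕ) :
    weight lam m n ^ 2 = (((n : ℝ) + 1) / ((m : ℝ) + 1)) ^ (2 * lam) := by
  rw [weight, ← Real.rpow_natCast, ← Real.rpow_mul (by positivity)]
  congr 1
  push_cast
  ring

theorem weight_succ_sq_le {lam : ℝ} (h0 : 0 ≤ lam) (h1 : 2 * lam ≤ 1) (m n : ℕ) :
    weight lam m (n + 1) ^ 2 ≤ weight lam m n ^ 2 * (1 + 2 * lam * ((n : ℝ) + 1)⁻¹) := by
  rw [weight_sq, weight_sq]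
  have h2 : (((n + 1 : ℕ) : ℝ) + 1) / ((m : ℝ) + 1)
      = ((n : ℝ) + 1) / ((m : ℝ) + 1) * (1 + ((n : ℝ) + 1)⁻¹) := by
    push_cast
    field_simp
  rw [h2, Real.mul_rpow (by positivity) (by positivity)]
  refine mul_le_mul_of_nonneg_left ?_ (by positivity)
  exact rpow_one_add_le_one_add_mul_self
    ((by norm_num : (-1 : ℝ) ≤ 0).trans (by positivity)) (by linarith) h1

theorem step_mul_weight_le {lam : ℝ} (h1 : lam ≤ 1) {m n : ℕ} (h : m ≤ n) :
    ((n : ℝ) + 1)⁻¹ * weight lam m n ≤ ((m : ℝ) + 1)⁻¹ := by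
  have h2 : weight lam m n ≤ ((n : ℝ) + 1) / ((m : ℝ) + 1) := by
    refine (Real.rpow_le_rpow_of_exponent_le ?_ h1).trans_eq (Real.rpow_one _)
    rw [one_le_div (by positivity)]
    gcongr
  calc ((n : ℝ) + 1)⁻¹ * weight lam m n
      ≤ ((n : ℝ) + 1)⁻¹ * (((n : ℝ) + 1) / ((m : ℝ) + 1)) := by gcongr
    _ = _ := by field_simp

theorem tailBound_nonneg {lam : ℝ} (h1 : 2 * lam < 1) (m n : ℕ) : 0 ≤ tailBound lam m n := by
  have : 0 < 1 - 2 * lam := by linarith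
  unfold tailBound
  positivity

theorem tailBound_self (lam : ℝ) (m : ℕ) :
    tailBound lam m m = 2 / (1 - 2 * lam) * ((m : ℝ) + 1)⁻¹ := by
  rw [tailBound, mul_assoc, ← Real.rpow_add (by positivity), ← Real.rpow_neg_one]
  congr 2
  ring

theorem sq_step_mul_weight_le {lam : ℝ} (h0 : 0 ≤ lam) (h1 : 2 * lam < 1) (m n : ℕ) :
    (((n : ℝ) + 1)⁻¹ * weight lam m n) ^ 2 ≤ tailBound lam m n - tailBound lam m (n + 1) := by
  have h2 := rpow_neg_div_le (a := (n : ℝ) + 1) (r := 1 - 2 * lam) (by simp) (by linarith)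
    (by linarith)
  have h3 : (((n : ℝ) + 1)⁻¹ * weight lam m n) ^ 2
      = ((m : ℝ) + 1) ^ (-(2 * lam)) * (((n : ℝ) + 1) ^ (-(1 - 2 * lam)) / ((n : ℝ) + 1)) := by
    rw [mul_pow, weight_sq, Real.div_rpow (by positivity) (by positivity),
      Real.rpow_neg (by positivity), neg_sub, Real.rpow_sub_one (by positivity)]
    field_simp
  rw [h3, tailBound, tailBound]
  refine (mul_le_mul_of_nonneg_left h2 (by positivity)).trans_eq ?_
  push_cast
  ring

/-! ### Concentration of the iterates -/

section

universe u

variable {S Act : Type*} [MeasurableSpace S] [MeasurableSpace Act] {d : ℕ}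
  {M : MDP S Act} (π : Policy S Act) (ν : Measure S) {F : Features S d}

variable {H : Type*} [NormedAddCommGroup H] [InnerProductSpace ℝ H]
  {J : Vec d →L[ℝ] H} {lam : ℝ}

/-- The matrix `A` is invertible when it is coercive in some norm, so `θ*` solves `A θ* = b`. -/
theorem A_θstar (hlam_pos : 0 < lam) (hJ1 : ∀ x, ‖x‖ ≤ ‖J x‖)
    (hJ2 : ∀ x, lam * ‖J x‖ ^ 2
      ≤ inner ℝ (J x) (J (Matrix.toEuclideanCLM (𝕜 := ℝ) (M.A π ν F) x))) :
    Matrix.toEuclideanCLM (𝕜 := ℝ) (M.A π ν F) (M.θstar π ν F)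
      = WithLp.toLp 2 (M.b π ν F) := by
  have hinj : Function.Injective (M.A π ν F).mulVec := by
    rw [← Matrix.coe_mulVecLin, ← LinearMap.ker_eq_bot, LinearMap.ker_eq_bot']
    intro v hv
    have h1 := hJ2 (WithLp.toLp 2 v)
    have h2 : Matrix.toEuclideanCLM (𝕜 := ℝ) (M.A π ν F) (WithLp.toLp 2 v) = 0 := by
      rw [Matrix.mulVecLin_apply] at hv
      rw [Matrix.toEuclideanCLM_toLp, hv]
      rfl
    rw [h2, map_zero, inner_zero_right] at h1
    have h3 : ‖J (WithLp.toLp 2 v)‖ = 0 := by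
      have h4 : ‖J (WithLp.toLp 2 v)‖ ^ 2 ≤ 0 := by
        by_contra hc
        exact absurd h1 (not_le.2 (mul_pos hlam_pos (not_le.1 hc)))
      exact pow_eq_zero_iff two_ne_zero |>.1 (le_antisymm h4 (sq_nonneg _))
    have h5 : (WithLp.toLp 2 v : Vec d) = 0 :=
      norm_eq_zero.1 (le_antisymm (h3 ▸ hJ1 _) (norm_nonneg _))
    simpa using h5
  have hunit : IsUnit (M.A π ν F).det :=
    (Matrix.isUnit_iff_isUnit_det _).1 (Matrix.mulVec_injective_iff_isUnit.1 hinj)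
  rw [MDP.θstar, Matrix.toEuclideanCLM_toLp, Matrix.mulVec_mulVec,
    Matrix.mul_nonsing_inv _ hunit, Matrix.one_mulVec]

/-- The weighted squared error of `θ` at time `n`, in the norm `‖J ·‖`, plus a constant that keeps
it above the level of the additive noise. -/
noncomputable def lyapunovValue (J : Vec d →L[ℝ] H) (lam : ℝ) (m : ℕ) (θs : Vec d) (n : ℕ)
    (θ : Vec d) : ℝ :=
  weight lam m n ^ 2 * ‖J (θ - θs)‖ ^ 2 + 1

theorem lyapunovValue_nonneg (J : Vec d →L[ℝ] H) (lam : ℝ) (m : ℕ) (θs : Vec d) (n : ℕ)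
    (θ : Vec d) : 0 ≤ lyapunovValue J lam m θs n θ := by
  unfold lyapunovValue
  positivity

/-- The `q`-th power of the Lyapunov value, corrected by the second-order errors still to come. -/
noncomputable def potential (J : Vec d →L[ℝ] H) (lam B : ℝ) (m q : ℕ) (θs : Vec d) (n : ℕ)
    (θ : Vec d) : ℝ≥0∞ :=
  ENNReal.ofReal (lyapunovValue J lam m θs n θ ^ q * Real.exp (B * q ^ 2 * tailBound lam m n))

theorem measurable_potential (J : Vec d →L[ℝ] H) (lam B : ℝ) (m q : ℕ) (θs : Vec d) (n : ℕ) :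
    Measurable (potential J lam B m q θs n) := by
  have h : Continuous fun θ => lyapunovValue J lam m θs n θ := by
    unfold lyapunovValue
    fun_prop
  exact ENNReal.measurable_ofReal.comp ((h.measurable.pow_const q).mul_const _)

/-- From a time `m` proportional to `q` on, the potential is a supermartingale along TD(0). -/
theorem lintegral_potential_le [IsProbabilityMeasure ν] [CompleteSpace H] (hbdd : M.Bounded F)
    (hlam_pos : 0 < lam) (hhalf : lam < 1 / 2)
    (hJ1 : ∀ x, ‖x‖ ≤ ‖J x‖)
    (hJ2 : ∀ x, lam * ‖J x‖ ^ 2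
      ≤ inner ℝ (J x) (J (Matrix.toEuclideanCLM (𝕜 := ℝ) (M.A π ν F) x)))
    {G : ℝ} (hG : ‖J‖ * (1 + ‖M.θstar π ν F‖) ≤ G) {q m n : ℕ} (hq : 1 ≤ q)
    (hmq : 16 * G * q ≤ (m : ℝ) + 1) (hn : m ≤ n) (θ : Vec d) :
    ∫⁻ z, potential J lam (264 * G ^ 2) m q (M.θstar π ν F) (n + 1)
        (θ + ((n : ℝ) + 1)⁻¹ • tdField M.γ θ z) ∂(M.sampleLaw π ν F)
      ≤ potential J lam (264 * G ^ 2) m q (M.θstar π ν F) n θ := by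
  set θs := M.θstar π ν F with hθs
  have hG0 : 0 ≤ G := le_trans (by positivity) hG
  have hα1 : ((n : ℝ) + 1)⁻¹ ≤ 1 := inv_le_one_of_one_le₀ (by simp)
  have hstep := lintegral_step_le (ρ := M.sampleLaw π ν F) J (θ - θs) (g := tdField M.γ θ)
    (G := G) (lam := lam)
    (α := ((n : ℝ) + 1)⁻¹) (u := weight lam m n) (u' := weight lam m (n + 1)) (q := q)
    hG0 ?_ ?_ ?_ (by linarith) (by positivity) hα1 (one_le_weight hlam_pos.le hn)
    (weight_succ_sq_le hlam_pos.le (by linarith) m n) hq ?_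
  · have hsplit : ∀ z, potential J lam (264 * G ^ 2) m q θs (n + 1)
          (θ + ((n : ℝ) + 1)⁻¹ • tdField M.γ θ z)
        = ENNReal.ofReal ((weight lam m (n + 1) ^ 2
            * ‖J (θ - θs + ((n : ℝ) + 1)⁻¹ • tdField M.γ θ z)‖ ^ 2 + 1) ^ q)
          * ENNReal.ofReal (Real.exp (264 * G ^ 2 * q ^ 2 * tailBound lam m (n + 1))) := by
      intro z
      rw [potential, lyapunovValue, ← ENNReal.ofReal_mul (by positivity), sub_add_eq_add_sub]
    simp_rw [hsplit]
    rw [lintegral_mul_const' _ _ ENNReal.ofReal_ne_top]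
    refine (mul_le_mul_left hstep _).trans ?_
    rw [← ENNReal.ofReal_mul (by positivity), mul_assoc, ← Real.exp_add]
    refine ENNReal.ofReal_le_ofReal ?_
    refine mul_le_mul_of_nonneg_left (Real.exp_le_exp.2 ?_) (by positivity)
    have h1 := mul_le_mul_of_nonneg_left (sq_step_mul_weight_le hlam_pos.le (by linarith) m n)
      (by positivity : 0 ≤ 264 * G ^ 2 * (q : ℝ) ^ 2)
    linarith
  · filter_upwards [ae_mem_boundedData π ν hbdd] with z hz
    have h1 : ‖θ‖ ≤ ‖θs‖ + ‖J (θ - θs)‖ := by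
      calc ‖θ‖ = ‖θs + (θ - θs)‖ := by rw [add_sub_cancel]
        _ ≤ ‖θs‖ + ‖θ - θs‖ := norm_add_le _ _
        _ ≤ _ := by gcongr; exact hJ1 _
    calc ‖J (tdField M.γ θ z)‖ ≤ ‖J‖ * (1 + ‖θ‖) :=
          (J.le_opNorm _).trans (by gcongr; exact norm_tdField_le M.γ_pos.le M.γ_lt_one.le θ hz)
      _ ≤ ‖J‖ * ((1 + ‖θs‖) * (1 + ‖J (θ - θs)‖)) := by
          gcongr
          nlinarith [mul_nonneg (norm_nonneg θs) (norm_nonneg (J (θ - θs)))]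
      _ ≤ G * (1 + ‖J (θ - θs)‖) := by
          rw [← mul_assoc]
          gcongr
  · have : Measurable fun z => (inner ℝ (ContinuousLinearMap.adjoint J (J (θ - θs)))
        (tdField M.γ θ z) : ℝ) :=
      ((measurable_tdField M.γ).comp measurable_prodMk_left).const_inner
    simp_rw [ContinuousLinearMap.adjoint_inner_left] at this
    exact this.aestronglyMeasurable
  · have h1 : ∀ v, (inner ℝ (J (θ - θs)) (J v) : ℝ)
        = inner ℝ (ContinuousLinearMap.adjoint J (J (θ - θs))) v :=
      fun v => (ContinuousLinearMap.adjoint_inner_left J v _).symm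
    have h2 : WithLp.toLp 2 (M.b π ν F) - Matrix.toEuclideanCLM (𝕜 := ℝ) (M.A π ν F) θ
        = -Matrix.toEuclideanCLM (𝕜 := ℝ) (M.A π ν F) (θ - θs) := by
      rw [← A_θstar π ν hlam_pos hJ1 hJ2, map_sub]; abel
    simp_rw [h1]
    rw [integral_inner_tdField π ν hbdd, h2, ← h1, map_neg, inner_neg_right]
    exact neg_le_neg (hJ2 _)
  · have h1 := step_mul_weight_le (lam := lam) (by linarith) hn
    calc (q : ℝ) * (16 * G * (((n : ℝ) + 1)⁻¹ * weight lam m n))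
        ≤ q * (16 * G * ((m : ℝ) + 1)⁻¹) := by gcongr
      _ = (16 * G * q) * ((m : ℝ) + 1)⁻¹ := by ring
      _ ≤ 1 := by
        rw [mul_inv_le_iff₀ (by positivity), one_mul]
        exact hmq

/-- At time `m` itself, only the linear growth of the iterates is available. -/
theorem potential_self_le {γ : ℝ} (hγ0 : 0 ≤ γ) (hγ1 : γ ≤ 1) (θ₀ θs : Vec d)
    {z : ℕ → Vec d × Vec d × ℝ} (hz : ∀ n, z n ∈ boundedData d) (hhalf : lam < 1 / 2) {B : ℝ}
    (hB : 0 ≤ B) {q m : ℕ} (hmq : (q : ℝ) ≤ m + 1) :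
    potential J lam B m q θs m (iterate γ (fun n => ((n : ℝ) + 1)⁻¹) θ₀ z m)
      ≤ ENNReal.ofReal (((1 + (‖J‖ * (‖θ₀‖ + 1 + ‖θs‖)) ^ 2)
          * Real.exp (B * (2 / (1 - 2 * lam))) * ((m : ℝ) + 1) ^ 2) ^ q) := by
  set x := iterate γ (fun n => ((n : ℝ) + 1)⁻¹) θ₀ z m with hx
  set C₁ := ‖J‖ * (‖θ₀‖ + 1 + ‖θs‖) with hC₁
  have hr0 : 0 < 1 - 2 * lam := by linarith
  have hm0 : (0 : ℝ) ≤ m := Nat.cast_nonneg m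
  have h1 : ‖J (x - θs)‖ ≤ C₁ * ((m : ℝ) + 1) := by
    have h2 := norm_iterate_add_one_le hγ0 hγ1 θ₀ hz m
    have h3 : ‖x‖ ≤ (‖θ₀‖ + 1) * ((m : ℝ) + 1) := by linarith
    calc ‖J (x - θs)‖ ≤ ‖J‖ * (‖x‖ + ‖θs‖) :=
          (J.le_opNorm _).trans (by gcongr; exact norm_sub_le _ _)
      _ ≤ ‖J‖ * ((‖θ₀‖ + 1) * ((m : ℝ) + 1) + ‖θs‖ * ((m : ℝ) + 1)) := by
          gcongr
          nlinarith [norm_nonneg θs]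
      _ = _ := by rw [hC₁]; ring
  have h4 : lyapunovValue J lam m θs m x ≤ (1 + C₁ ^ 2) * ((m : ℝ) + 1) ^ 2 := by
    have hw : weight lam m m = 1 := by
      rw [weight, div_self (by positivity), Real.one_rpow]
    have h5 : ‖J (x - θs)‖ ^ 2 ≤ (C₁ * ((m : ℝ) + 1)) ^ 2 := by gcongr
    have h6 : (1 : ℝ) ≤ ((m : ℝ) + 1) ^ 2 := one_le_pow₀ (by simp)
    rw [lyapunovValue, hw]
    linarith
  have h7 : B * q ^ 2 * tailBound lam m m ≤ q * (B * (2 / (1 - 2 * lam))) := by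
    rw [tailBound_self]
    have h8 : (q : ℝ) * ((m : ℝ) + 1)⁻¹ ≤ 1 := by
      rwa [mul_inv_le_iff₀ (by positivity), one_mul]
    calc B * q ^ 2 * (2 / (1 - 2 * lam) * ((m : ℝ) + 1)⁻¹)
        = q * (B * (2 / (1 - 2 * lam))) * (q * ((m : ℝ) + 1)⁻¹) := by ring
      _ ≤ q * (B * (2 / (1 - 2 * lam))) * 1 := by gcongr
      _ = _ := mul_one _
  refine ENNReal.ofReal_le_ofReal ?_
  calc lyapunovValue J lam m θs m x ^ q * Real.exp (B * q ^ 2 * tailBound lam m m)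
      ≤ ((1 + C₁ ^ 2) * ((m : ℝ) + 1) ^ 2) ^ q * Real.exp (q * (B * (2 / (1 - 2 * lam)))) := by
        gcongr
        exact lyapunovValue_nonneg _ _ _ _ _ _
    _ = _ := by
        rw [Real.exp_nat_mul, ← mul_pow]
        ring

theorem norm_sub_le_of_potential_lt (hJ1 : ∀ x, ‖x‖ ≤ ‖J x‖) (hlam_pos : 0 < lam)
    (hhalf : lam < 1 / 2) {B Y : ℝ} (hB : 0 ≤ B) (hY : 0 < Y) {q m n : ℕ} (hn : m ≤ n)
    {θs θ : Vec d}
    (h : potential J lam B m q θs n θ < ENNReal.ofReal ((Y * ((m : ℝ) + 1) ^ 2) ^ q)) :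
    ‖θ - θs‖ ≤ √Y * ((m : ℝ) + 1) / weight lam m n := by
  have hw := one_le_weight hlam_pos.le hn
  have h2 := (ENNReal.ofReal_lt_ofReal_iff (by positivity)).1 h
  have h3 : lyapunovValue J lam m θs n θ ^ q < (Y * ((m : ℝ) + 1) ^ 2) ^ q := by
    refine lt_of_le_of_lt (le_mul_of_one_le_right
      (pow_nonneg (lyapunovValue_nonneg _ _ _ _ _ _) q) ?_) h2
    exact Real.one_le_exp (mul_nonneg (by positivity) (tailBound_nonneg (by linarith) m n))
  have h4 := lt_of_pow_lt_pow_left₀ q (by positivity) h3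
  have h5 : ‖J (θ - θs)‖ * weight lam m n ≤ √Y * ((m : ℝ) + 1) := by
    refine le_of_sq_le_sq ?_ (by positivity)
    rw [mul_pow, mul_pow (√_), Real.sq_sqrt hY.le]
    rw [lyapunovValue] at h4
    linarith
  rw [le_div_iff₀ (by linarith)]
  refine le_trans ?_ h5
  gcongr
  exact hJ1 _

/-- With probability at least `1 - e^{-q}`, from a time `m` proportional to `q` on the error decays
like `n ^ (-lam)`, starting from its worst-case size, which is linear in `m`. -/
theorem iterate_concentration [IsProbabilityMeasure ν] [NeZero d] (hbdd : M.Bounded F)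
    (hlam_pos : 0 < lam)
    (hlam : ∀ μ ∈ spectrum ℂ ((M.A π ν F).map Complex.ofReal), lam < μ.re) (θ₀ : Vec d) :
    ∃ (C : ℝ) (m₀ : ℕ), 0 < C ∧
      ∀ {Ω : Type u} [MeasurableSpace Ω] (Pr : Measure Ω) [IsProbabilityMeasure Pr]
        (Z : ℕ → Ω → Vec d × Vec d × ℝ), IsIIDSample Pr (M.sampleLaw π ν F) Z →
        ∀ q : ℕ, 1 ≤ q →
          1 - Real.exp (-q) ≤ Pr.real {ω | ∀ n : ℕ, m₀ * q ≤ n →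
            ‖iterate M.γ (fun n => ((n : ℝ) + 1)⁻¹) θ₀ (fun m => Z m ω) n - M.θstar π ν F‖
              ≤ C * ((m₀ * q : ℕ) + 1) / weight lam (m₀ * q) n} := by
  have hhalf := lam_lt_half π ν hbdd hlam
  obtain ⟨K, J, hJ1, hJ2⟩ := exists_lyapunov (M.A π ν F) hlam_pos hlam
  set θs := M.θstar π ν F with hθs
  obtain ⟨G, hG, hG1⟩ : ∃ G : ℝ, ‖J‖ * (1 + ‖θs‖) ≤ G ∧ 1 ≤ G :=
    ⟨_, le_max_left _ _, le_max_right _ 1⟩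
  set D := (1 + (‖J‖ * (‖θ₀‖ + 1 + ‖θs‖)) ^ 2)
    * Real.exp (264 * G ^ 2 * (2 / (1 - 2 * lam))) with hD
  have hD0 : 0 < D := by positivity
  refine ⟨√(Real.exp 1 * D), ⌈16 * G⌉₊, Real.sqrt_pos.2 (by positivity), ?_⟩
  intro Ω _ Pr _ Z hZ q hq
  have hq1 : (1 : ℝ) ≤ q := by exact_mod_cast hq
  set m := ⌈16 * G⌉₊ * q with hm
  have hmq : 16 * G * q ≤ (m : ℝ) + 1 := by
    rw [hm]
    push_cast
    have := mul_le_mul_of_nonneg_right (Nat.le_ceil (16 * G)) (by linarith : (0 : ℝ) ≤ q)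
    linarith
  set x : ℕ → Ω → Vec d :=
    fun n ω => iterate M.γ (fun n => ((n : ℝ) + 1)⁻¹) θ₀ (fun m => Z m ω) n with hx
  have hTm : ∀ n : ℕ, Measurable (Function.uncurry
      fun (θ : Vec d) z => θ + ((n : ℝ) + 1)⁻¹ • tdField M.γ θ z) := fun n =>
    measurable_fst.add ((measurable_tdField (d := d) M.γ).const_smul ((n : ℝ) + 1)⁻¹)
  set b := (Real.exp 1 * D * ((m : ℝ) + 1) ^ 2) ^ q with hb
  have hb0 : 0 < b := by positivity
  have hville := ville_inequality hZ (x := x) (x₀ := θ₀) (fun _ => rfl) hTm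
    (fun n ω => iterate_succ _ _ _ _ _) (measurable_potential J lam (264 * G ^ 2) m q θs)
    (fun n hn => lintegral_potential_le π ν hbdd hlam_pos hhalf hJ1 hJ2 hG hq hmq hn)
    (ENNReal.ofReal b)
  have hinit : ∫⁻ ω, potential J lam (264 * G ^ 2) m q θs m (x m ω) ∂Pr
      ≤ ENNReal.ofReal b * ENNReal.ofReal (Real.exp (-q)) := by
    have hgood : ∀ᵐ ω ∂Pr, ∀ n, Z n ω ∈ boundedData d := by
      refine ae_all_iff.2 fun n => ?_
      have h := ae_mem_boundedData π ν hbdd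
      rw [← hZ.law n] at h
      exact ae_of_ae_map (hZ.measurable n).aemeasurable h
    have hpt : ∀ᵐ ω ∂Pr, potential J lam (264 * G ^ 2) m q θs m (x m ω)
        ≤ ENNReal.ofReal b * ENNReal.ofReal (Real.exp (-q)) := by
      filter_upwards [hgood] with ω hω
      refine (potential_self_le M.γ_pos.le M.γ_lt_one.le θ₀ θs hω hhalf (by positivity)
        (by nlinarith)).trans_eq ?_
      have he : Real.exp 1 ^ q * Real.exp (-q) = 1 := by
        rw [← Real.exp_nat_mul, ← Real.exp_add]
        simp
      have hbe : b * Real.exp (-q) = (D * ((m : ℝ) + 1) ^ 2) ^ q := by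
        rw [hb, mul_assoc (Real.exp 1), mul_pow (Real.exp 1), mul_right_comm, he, one_mul]
      rw [← ENNReal.ofReal_mul hb0.le, hbe]
    refine (lintegral_mono_ae hpt).trans ?_
    simp
  have hbad : Pr {ω | ∃ n, m ≤ n ∧
        ENNReal.ofReal b ≤ potential J lam (264 * G ^ 2) m q θs n (x n ω)}
      ≤ ENNReal.ofReal (Real.exp (-q)) := by
    have h1 := hville.trans hinit
    rwa [ENNReal.mul_le_mul_iff_right (by simpa using hb0) ENNReal.ofReal_ne_top] at h1
  have hcover : univ ⊆ {ω | ∀ n : ℕ, m ≤ n →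
        ‖x n ω - θs‖ ≤ √(Real.exp 1 * D) * ((m : ℝ) + 1) / weight lam m n}
      ∪ {ω | ∃ n, m ≤ n ∧ ENNReal.ofReal b ≤ potential J lam (264 * G ^ 2) m q θs n (x n ω)} := by
    intro ω _
    by_contra hω
    rw [mem_union, not_or] at hω
    refine hω.1 fun n hn => ?_
    refine norm_sub_le_of_potential_lt hJ1 hlam_pos hhalf (B := 264 * G ^ 2) (q := q)
      (by positivity) (by positivity) hn ?_
    by_contra hc
    exact hω.2 ⟨n, hn, not_lt.1 hc⟩
  have hsum := (measureReal_mono (μ := Pr) hcover).trans (measureReal_union_le _ _)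
  have hbad' := ENNReal.toReal_le_of_le_ofReal (Real.exp_pos _).le hbad
  rw [probReal_univ] at hsum
  rw [← measureReal_def] at hbad'
  linarith

end

/-! ### The waiting time -/

/-- The time from which the error bound of `iterate_concentration`, at the confidence level
`q = ⌈log (1 / δ)⌉`, is at most `ε`. -/
noncomputable def waitingTime (lam C : ℝ) (m₀ : ℕ) (ε δ : ℝ) : ℕ :=
  max (m₀ * ⌈Real.log (1 / δ)⌉₊)
    ⌈(C / ε * (((m₀ * ⌈Real.log (1 / δ)⌉₊ : ℕ) : ℝ) + 1) ^ (1 + lam)) ^ (1 / lam)⌉₊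

theorem div_weight_le_of_waitingTime_le {lam C ε δ : ℝ} {m₀ n : ℕ} (hlam : 0 < lam) (hC : 0 < C)
    (hε : 0 < ε) (hn : waitingTime lam C m₀ ε δ ≤ n) :
    C * (((m₀ * ⌈Real.log (1 / δ)⌉₊ : ℕ) : ℝ) + 1)
      / weight lam (m₀ * ⌈Real.log (1 / δ)⌉₊) n ≤ ε := by
  have h1 := (le_max_right _ _).trans hn
  set m := m₀ * ⌈Real.log (1 / δ)⌉₊
  have hm : (0 : ℝ) < (m : ℝ) + 1 := by positivity
  have hn1 : (0 : ℝ) < (n : ℝ) + 1 := by positivity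
  have h2 : (C / ε * ((m : ℝ) + 1) ^ (1 + lam)) ^ (1 / lam) ≤ (n : ℝ) + 1 := by
    have := Nat.ceil_le.1 h1
    linarith
  have h3 : C / ε * ((m : ℝ) + 1) ^ (1 + lam) ≤ ((n : ℝ) + 1) ^ lam := by
    rw [one_div] at h2
    exact (Real.rpow_inv_le_iff_of_pos (by positivity) hn1.le hlam).1 h2
  rw [Real.rpow_add hm, Real.rpow_one] at h3
  rw [weight, Real.div_rpow hn1.le hm.le, div_div_eq_mul_div, div_le_iff₀ (by positivity)]
  calc C * ((m : ℝ) + 1) * ((m : ℝ) + 1) ^ lam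
      = ε * (C / ε * (((m : ℝ) + 1) * ((m : ℝ) + 1) ^ lam)) := by field_simp
    _ ≤ _ := by gcongr

theorem isSoftO_waitingTime {lam C : ℝ} (m₀ : ℕ) (hlam : 0 < lam) (hC : 0 < C) :
    IsSoftO (waitingTime lam C m₀) (rate lam) := by
  refine ⟨0, fun ε₀ hε₀ δ₀ hδ₀ => ?_⟩
  set p := 1 + 1 / lam with hp
  have hp0 : 0 < 1 / lam := by positivity
  set L₀ := Real.log (1 / δ₀) with hL₀
  have hL₀pos : 0 < L₀ := Real.log_pos (by rw [lt_div_iff₀ hδ₀.1]; linarith [hδ₀.2])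
  set K := m₀ * (1 + 1 / L₀) + 1 / L₀ with hK
  have hK0 : 0 < K := by positivity
  refine ⟨K * (1 / L₀) ^ (1 / lam) * ε₀ ^ p + C ^ (1 / lam) * ε₀ * K ^ p, fun ε hε δ hδ => ?_⟩
  obtain ⟨hε, hεle⟩ := hε
  obtain ⟨hδ, hδle⟩ := hδ
  rw [pow_zero, mul_one]
  set L := Real.log (1 / δ) with hL
  have hLL : L₀ ≤ L := Real.log_le_log (by have := hδ₀.1; positivity) (by gcongr)
  have hLpos : 0 < L := hL₀pos.trans_le hLL
  set m := m₀ * ⌈L⌉₊ with hm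
  have h1L : 1 ≤ 1 / L₀ * L := by
    rw [one_div, inv_mul_eq_div, one_le_div hL₀pos]; exact hLL
  have hmK : (m : ℝ) + 1 ≤ K * L := by
    have h1 : (⌈L⌉₊ : ℝ) ≤ L + 1 := (Nat.ceil_lt_add_one hLpos.le).le
    calc (m : ℝ) + 1 = m₀ * ⌈L⌉₊ + 1 := by rw [hm]; push_cast; ring
      _ ≤ m₀ * (L + 1 / L₀ * L) + 1 / L₀ * L := by gcongr; linarith
      _ = K * L := by rw [hK]; ring
  have hm0 : (0 : ℝ) < (m : ℝ) + 1 := by positivity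
  have hpow : ∀ a : ℝ, 0 < a → a ^ p = a * a ^ (1 / lam) := fun a ha => by
    rw [hp, Real.rpow_add ha, Real.rpow_one]
  set W := (C / ε * ((m : ℝ) + 1) ^ (1 + lam)) ^ (1 / lam) with hW
  have hW0 : 0 ≤ W := by positivity
  have hWle : W ≤ C ^ (1 / lam) * ε₀ * K ^ p * ((1 / ε) ^ p * L ^ p) := by
    have h1 : W = C ^ (1 / lam) * (1 / ε) ^ (1 / lam) * ((m : ℝ) + 1) ^ p := by
      rw [hW, Real.mul_rpow (by positivity) (by positivity), div_eq_mul_one_div,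
        Real.mul_rpow hC.le (by positivity), ← Real.rpow_mul hm0.le]
      congr 2
      rw [hp]
      field_simp
      ring
    have h2 : (1 / ε) ^ (1 / lam) ≤ ε₀ * (1 / ε) ^ p := by
      rw [hpow _ (by positivity), ← mul_assoc]
      refine le_mul_of_one_le_left (by positivity) ?_
      rw [mul_one_div, one_le_div hε]
      exact hεle
    calc W ≤ C ^ (1 / lam) * (ε₀ * (1 / ε) ^ p) * (K * L) ^ p := by
          rw [h1]
          gcongr
      _ = _ := by rw [Real.mul_rpow hK0.le hLpos.le]; ring
  have hmle : (m : ℝ) + 1 ≤ K * (1 / L₀) ^ (1 / lam) * ε₀ ^ p * ((1 / ε) ^ p * L ^ p) := by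
    have h1 : 1 ≤ ε₀ ^ p * (1 / ε) ^ p := by
      rw [← Real.mul_rpow hε₀.le (by positivity)]
      refine Real.one_le_rpow ?_ (by positivity)
      rw [mul_one_div, one_le_div hε]
      exact hεle
    have h2 : L ≤ (1 / L₀) ^ (1 / lam) * L ^ p := by
      rw [hpow L hLpos, mul_left_comm, ← Real.mul_rpow (by positivity) hLpos.le]
      exact le_mul_of_one_le_right hLpos.le (Real.one_le_rpow h1L hp0.le)
    calc (m : ℝ) + 1 ≤ K * ((1 / L₀) ^ (1 / lam) * L ^ p) := hmK.trans (by gcongr)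
      _ ≤ K * ((1 / L₀) ^ (1 / lam) * L ^ p) * (ε₀ ^ p * (1 / ε) ^ p) :=
          le_mul_of_one_le_right (by positivity) h1
      _ = _ := by ring
  have hN : (waitingTime lam C m₀ ε δ : ℝ) ≤ ((m : ℝ) + 1) + W := by
    rw [waitingTime, ← hL, ← hm, ← hW, Nat.cast_max]
    refine max_le (by linarith) ?_
    have := (Nat.ceil_lt_add_one hW0).le
    have hm0' : (0 : ℝ) ≤ m := Nat.cast_nonneg m
    linarith
  calc (waitingTime lam C m₀ ε δ : ℝ)
      ≤ (K * (1 / L₀) ^ (1 / lam) * ε₀ ^ p + C ^ (1 / lam) * ε₀ * K ^ p)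
          * ((1 / ε) ^ p * L ^ p) := by
        rw [add_mul]; linarith
    _ ≤ _ := by
        refine mul_le_mul_of_nonneg_left ?_ (by positivity)
        exact le_max_left _ _

end TDZero

theorem theorem2 {S Act : Type*} [MeasurableSpace S] [MeasurableSpace Act] {d : ℕ}
    (M : TDZero.MDP S Act) (π : TDZero.Policy S Act) (F : TDZero.Features S d)
    (hbdd : M.Bounded F)
    (ν : Measure S) [IsProbabilityMeasure ν] (hν : (M.chain π).Invariant ν)
    (lam : ℝ) (hlam_pos : 0 < lam)
    (hlam : ∀ μ : ℂ,
      Module.End.HasEigenvalue (Matrix.toLin' ((M.A π ν F).map Complex.ofReal)) μ → lam < μ.re)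
    (θ₀ : TDZero.Vec d) :
    ∃ N : ℝ → ℝ → ℕ,
      TDZero.IsSoftO N (TDZero.rate lam) ∧
      ∀ {Ω : Type*} [MeasurableSpace Ω] (Pr : Measure Ω) [IsProbabilityMeasure Pr]
        (Z : ℕ → Ω → TDZero.Vec d × TDZero.Vec d × ℝ),
        TDZero.IsIIDSample Pr (M.sampleLaw π ν F) Z →
        ∀ ε : ℝ, 0 < ε → ∀ δ ∈ Ioo (0 : ℝ) 1,
          1 - δ ≤ Pr.real {ω | ∀ n : ℕ, N ε δ ≤ n →
            ‖TDZero.iterate M.γ (fun n => ((n : ℝ) + 1)⁻¹) θ₀ (fun m => Z m ω) n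
              - M.θstar π ν F‖ ≤ ε} := by
  rcases Nat.eq_zero_or_pos d with rfl | hd
  · -- on the zero space there is no error
    refine ⟨_, TDZero.isSoftO_waitingTime 0 hlam_pos one_pos, ?_⟩
    intro Ω _ Pr _ Z _ ε hε δ hδ
    have huniv : ∀ N : ℕ, {ω | ∀ n : ℕ, N ≤ n →
        ‖TDZero.iterate M.γ (fun n => ((n : ℝ) + 1)⁻¹) θ₀ (fun m => Z m ω) n
          - M.θstar π ν F‖ ≤ ε} = univ := by
      refine fun N => eq_univ_of_forall fun ω n _ => ?_
      rw [Subsingleton.elim (_ - _) (0 : TDZero.Vec 0), norm_zero]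
      exact hε.le
    rw [huniv, probReal_univ]
    linarith [hδ.1]
  · have : NeZero d := ⟨hd.ne'⟩
    have hspec : ∀ μ ∈ spectrum ℂ ((M.A π ν F).map Complex.ofReal), lam < μ.re := by
      intro μ hμ
      rw [← Matrix.spectrum_toLin'] at hμ
      exact hlam μ (Module.End.hasEigenvalue_iff_mem_spectrum.2 hμ)
    obtain ⟨C, m₀, hC, hconc⟩ := TDZero.iterate_concentration π ν hbdd hlam_pos hspec θ₀
    refine ⟨_, TDZero.isSoftO_waitingTime m₀ hlam_pos hC, ?_⟩
    intro Ω _ Pr _ Z hZ ε hε δ hδ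
    have hlog : 0 < Real.log (1 / δ) := Real.log_pos (by rw [lt_div_iff₀ hδ.1]; linarith [hδ.2])
    have hexp : Real.exp (-(⌈Real.log (1 / δ)⌉₊ : ℝ)) ≤ δ := by
      rw [← Real.le_log_iff_exp_le hδ.1]
      have := Nat.le_ceil (Real.log (1 / δ))
      rw [one_div, Real.log_inv] at this ⊢
      linarith
    refine le_trans ?_ ((hconc Pr Z hZ ⌈Real.log (1 / δ)⌉₊ (Nat.ceil_pos.2 hlog)).trans
      (measureReal_mono fun ω hω n hn => ?_))
    · linarith
    · exact (hω n ((le_max_left _ _).trans hn)).trans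
        (TDZero.div_weight_le_of_waitingTime_le hlam_pos hC hε hn)
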